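/- **Setting.** Let $W^\natural,\Delta\in\mathbb R^{d\times k}$ with $1\le r^*:=\operatorname{rank}(\Delta)<\min\{d,k\}$, let $r^*\le r\le\min\{d,k\}$ and $d<N$. Write $\lambda^*_1\ge\dots\ge\lambda^*_{r^*}>0$ for the nonzero singular values of $\Delta$ and $\kappa=\lambda^*_1/\lambda^*_{r^*}$. Let $x_1,\dots,x_N\in\mathbb R^d$ be i.i.d. random vectors whose law is centered, isotropic ($\mathbb E\,xx^\top=I_d$) and sub-Gaussian with sub-Gaussian norm at most $K$, i.e. $\mathbb E\exp(\langle u,x\rangle^2/K^2)\le 2$ for every unit vector $u$. Let $X\in\mathbb R^{N\times d}$ be the matrix with rows $x_i^\top$, $Y=X(W^\natural+\Delta)$ and $\widehat\Sigma=\frac1N X^\top X$. Let $G^\natural=-\frac1N X^\top(XW^\natural-Y)$ be the negative gradient at $W^\natural$ of $L(W)=\frac1{2N}\|XW-Y\|_F^2$, and let $G^\natural=\widetilde U\widetilde S\widetilde V^\top$ be any complete singular value decomposition (singular values in nonincreasing order). Consider the spectral initialization $$A_0=\widetilde U_{[:,1:r]}\,\widetilde S^{1/2}_{[1:r]}\in\mathbb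 R^{d\times r},\qquad B_0=\widetilde S^{1/2}_{[1:r]}\,\widetilde V_{[:,1:r]}^\top\in\mathbb R^{r\times k},$$ and preconditioned gradient descent with Moore–Penrose pseudo-inverses, $$A_{t+1}=A_t-\tfrac{\eta}{N}X^\top\big(X(W^\natural+A_tB_t)-Y\big)B_t^\top(B_tB_t^\top)^\dagger,$$ $$B_{t+1}=B_t-\tfrac{\eta}{N}(A_t^\top A_t)^\dagger A_t^\top X^\top\big(X(W^\natural+A_tB_t)-Y\big).$$ **Theorem.** There is a universal constant $C>0$ and, for every $K>0$, a constant $c>0$ depending only on $K$, such that in the above setting, whenever $$0<\epsilon\le\min\Big\{\frac1{2\sqrt{r^*}\,\kappa},\ \frac14\Big\},\qquad \eta\in\Big(0,\ \frac{0.5-2\epsilon}{(1+\epsilon)^2}\Big),$$ with probability at least $1-2\,C^{d}\exp(-c\,\epsilon^2N)$ one has $\|\widehat\Sigma-I_d\|_{op}\le\epsilon$ and, for every choice of the singular value decomposition of $G^\natural$ and all $t\ge0$ simultaneously, $$\|A_tB_t-\Delta\|_F\le\frac12\Big(1-\frac{\eta}{2}\Big)^t\lambda^*_{r^*}.$$ In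 particular the rate does not depend on the condition number $\kappa$. -/

import Mathlib

open MeasureTheory ProbabilityTheory
open scoped Matrix RealInnerProductSpace

noncomputable section

namespace LoRA

/-! ### Matrix norms and singular values -/

section Norms

open scoped Matrix.Norms.Frobenius

/-- The Frobenius norm of a real matrix. -/
def frobeniusNorm {m n : ℕ} (M : Matrix (Fin m) (Fin n) ℝ) : ℝ := ‖M‖

end Norms

/-- The operator norm of a square real matrix with respect to Euclidean norms. -/
def opNorm {n : ℕ} (M : Matrix (Fin n) (Fin n) ℝ) : ℝ :=
  ‖Matrix.toEuclideanCLM (n := Fin n) (𝕜 := ℝ) M‖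

/-- `singularValue M i` is the `i`-th largest singular value of `M`, counted from `i = 1`
with multiplicity. (Mathlib counts from zero.) -/
def singularValue {m n : ℕ} (M : Matrix (Fin m) (Fin n) ℝ) (i : ℕ) : ℝ :=
  (Matrix.toEuclideanLin M).singularValues (i - 1)

/-- The condition number `λ₁ / λ_{rank}` of a matrix of positive rank: the ratio of its largest
to its smallest nonzero singular value. -/
def conditionNumber {m n : ℕ} (M : Matrix (Fin m) (Fin n) ℝ) : ℝ :=
  singularValue M 1 / singularValue M M.rank

/-! ### The Moore–Penrose pseudo-inverse -/

/-- The four Penrose equations: `Z` is a pseudo-inverse of `M`. -/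
structure IsMoorePenrose {m n : ℕ} (M : Matrix (Fin m) (Fin n) ℝ)
    (Z : Matrix (Fin n) (Fin m) ℝ) : Prop where
  mul_mul_left : M * Z * M = M
  mul_mul_right : Z * M * Z = Z
  symm_left : (M * Z)ᵀ = M * Z
  symm_right : (Z * M)ᵀ = Z * M

theorem IsMoorePenrose.unique {m n : ℕ} {M : Matrix (Fin m) (Fin n) ℝ}
    {Y Z : Matrix (Fin n) (Fin m) ℝ} (hY : IsMoorePenrose M Y) (hZ : IsMoorePenrose M Z) :
    Y = Z := by
  have h1 : M * Y = M * Z := by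
    calc M * Y = (M * Y)ᵀ := hY.symm_left.symm
      _ = ((M * Z) * (M * Y))ᵀ := by rw [← Matrix.mul_assoc, hZ.mul_mul_left]
      _ = (M * Y) * (M * Z) := by rw [Matrix.transpose_mul, hY.symm_left, hZ.symm_left]
      _ = M * Z := by rw [← Matrix.mul_assoc, hY.mul_mul_left]
  have h2 : Y * M = Z * M := by
    calc Y * M = (Y * M)ᵀ := hY.symm_right.symm
      _ = ((Y * M) * (Z * M))ᵀ := by
          rw [Matrix.mul_assoc, ← Matrix.mul_assoc M Z M, hZ.mul_mul_left]
      _ = (Z * M) * (Y * M) := by rw [Matrix.transpose_mul, hY.symm_right, hZ.symm_right]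
      _ = Z * M := by rw [Matrix.mul_assoc, ← Matrix.mul_assoc M Y M, hY.mul_mul_left]
  calc Y = Y * M * Y := hY.mul_mul_right.symm
    _ = Z * (M * Z) := by rw [h2, Matrix.mul_assoc, h1]
    _ = Z := by rw [← Matrix.mul_assoc, hZ.mul_mul_right]

theorem exists_isMoorePenrose_of_isHermitian {n : ℕ} {H : Matrix (Fin n) (Fin n) ℝ}
    (hH : H.IsHermitian) : ∃ Z, Zᵀ = Z ∧ IsMoorePenrose H Z := by
  set Q : Matrix (Fin n) (Fin n) ℝ := (hH.eigenvectorUnitary : Matrix (Fin n) (Fin n) ℝ)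
  set D : Matrix (Fin n) (Fin n) ℝ := Matrix.diagonal hH.eigenvalues
  set D' : Matrix (Fin n) (Fin n) ℝ := Matrix.diagonal fun i => (hH.eigenvalues i)⁻¹
  have hQ : Qᵀ * Q = 1 := by
    have := (Matrix.mem_unitaryGroup_iff').1 hH.eigenvectorUnitary.2
    simpa [Matrix.star_eq_conjTranspose] using this
  have hspec : H = Q * D * Qᵀ := by
    have := hH.spectral_theorem
    simpa [Matrix.star_eq_conjTranspose, Unitary.conjStarAlgAut_apply, Function.comp_def]
      using this
  have key : ∀ S T : Matrix (Fin n) (Fin n) ℝ,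
      (Q * S * Qᵀ) * (Q * T * Qᵀ) = Q * (S * T) * Qᵀ := by
    intro S T
    calc (Q * S * Qᵀ) * (Q * T * Qᵀ) = Q * S * (Qᵀ * Q) * T * Qᵀ := by
          simp only [Matrix.mul_assoc]
      _ = Q * (S * T) * Qᵀ := by rw [hQ]; simp only [Matrix.mul_assoc, Matrix.mul_one]
  have hsymm : ∀ v : Fin n → ℝ,
      (Q * Matrix.diagonal v * Qᵀ)ᵀ = Q * Matrix.diagonal v * Qᵀ := by
    intro v
    simp [Matrix.transpose_mul, Matrix.mul_assoc]
  refine ⟨Q * D' * Qᵀ, hsymm _, ?_, ?_, ?_, ?_⟩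
  · rw [hspec, key, key]
    congr 2
    simp only [D, D', Matrix.diagonal_mul_diagonal]
    congr 1; funext i
    by_cases h : hH.eigenvalues i = 0 <;> simp [h]
  · rw [hspec, key, key]
    congr 2
    simp only [D, D', Matrix.diagonal_mul_diagonal]
    congr 1; funext i
    by_cases h : hH.eigenvalues i = 0 <;> simp [h]
  · rw [hspec, key]
    simp only [D, D', Matrix.diagonal_mul_diagonal, hsymm]
  · rw [hspec, key]
    simp only [D, D', Matrix.diagonal_mul_diagonal, hsymm]

theorem exists_isMoorePenrose {m n : ℕ} (M : Matrix (Fin m) (Fin n) ℝ) :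
    ∃ Z, IsMoorePenrose M Z := by
  have hH : (Mᵀ * M).IsHermitian := by
    simpa using Matrix.isHermitian_conjTranspose_mul_self M
  obtain ⟨Z, hZs, hZ⟩ := exists_isMoorePenrose_of_isHermitian hH
  have h0 : Mᵀ * (M * (Z * (Mᵀ * M)) - M) = 0 := by
    rw [Matrix.mul_sub, ← Matrix.mul_assoc, ← Matrix.mul_assoc, hZ.mul_mul_left, sub_self]
  have h1 : M * (Z * (Mᵀ * M)) = M := by
    have h2 : (M * (Z * (Mᵀ * M)) - M)ᵀ * (M * (Z * (Mᵀ * M)) - M) = 0 := by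
      have h3 : M * (Z * (Mᵀ * M)) - M = M * (Z * (Mᵀ * M) - 1) := by
        rw [Matrix.mul_sub, Matrix.mul_one]
      conv_lhs => rw [h3, Matrix.transpose_mul, ← h3, Matrix.mul_assoc, h0, Matrix.mul_zero]
    rw [← Matrix.conjTranspose_eq_transpose_of_trivial,
      Matrix.conjTranspose_mul_self_eq_zero] at h2
    exact sub_eq_zero.1 h2
  refine ⟨Z * Mᵀ, ?_, ?_, ?_, ?_⟩
  · simpa only [Matrix.mul_assoc] using h1
  · calc Z * Mᵀ * M * (Z * Mᵀ) = (Z * (Mᵀ * M) * Z) * Mᵀ := by simp only [Matrix.mul_assoc]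
      _ = Z * Mᵀ := by rw [hZ.mul_mul_right]
  · simp only [Matrix.transpose_mul, Matrix.transpose_transpose, hZs, Matrix.mul_assoc]
  · rw [Matrix.mul_assoc]; exact hZ.symm_right

/-- The Moore–Penrose pseudo-inverse `M†`. -/
def pinv {m n : ℕ} (M : Matrix (Fin m) (Fin n) ℝ) : Matrix (Fin n) (Fin m) ℝ :=
  (exists_isMoorePenrose M).choose

theorem isMoorePenrose_pinv {m n : ℕ} (M : Matrix (Fin m) (Fin n) ℝ) :
    IsMoorePenrose M (pinv M) :=
  (exists_isMoorePenrose M).choose_spec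

/-! ### Complete singular value decompositions and spectral initialization -/

/-- The `m × n` matrix with `σ` on its main diagonal and zeros elsewhere. -/
def rectDiagonal {m n : ℕ} (σ : Fin (min m n) → ℝ) : Matrix (Fin m) (Fin n) ℝ :=
  Matrix.of fun i j =>
    if h : (i : ℕ) = (j : ℕ) then σ ⟨i, lt_min i.2 (h ▸ j.2)⟩ else 0

/-- `M = U S Vᵀ` is a complete singular value decomposition: `U` and `V` are orthogonal and `S` is
the rectangular diagonal matrix of nonnegative numbers `σ` in nonincreasing order. -/
structure IsSVD {m n : ℕ} (M : Matrix (Fin m) (Fin n) ℝ) (U : Matrix (Fin m) (Fin m) ℝ)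
    (σ : Fin (min m n) → ℝ) (V : Matrix (Fin n) (Fin n) ℝ) : Prop where
  left_mem : U ∈ Matrix.orthogonalGroup (Fin m) ℝ
  right_mem : V ∈ Matrix.orthogonalGroup (Fin n) ℝ
  nonneg : ∀ i, 0 ≤ σ i
  antitone : Antitone σ
  eq : M = U * rectDiagonal σ * Vᵀ

/-- `A₀ = U[:, 1:r] S^{1/2}[1:r]`. -/
def spectralInitA {d k r : ℕ} (hrd : r ≤ d) (hrk : r ≤ k) (U : Matrix (Fin d) (Fin d) ℝ)
    (σ : Fin (min d k) → ℝ) : Matrix (Fin d) (Fin r) ℝ :=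
  U.submatrix id (Fin.castLE hrd) *
    Matrix.diagonal fun a : Fin r => √(σ (Fin.castLE (le_min hrd hrk) a))

/-- `B₀ = S^{1/2}[1:r] V[:, 1:r]ᵀ`. -/
def spectralInitB {d k r : ℕ} (hrd : r ≤ d) (hrk : r ≤ k) (σ : Fin (min d k) → ℝ)
    (V : Matrix (Fin k) (Fin k) ℝ) : Matrix (Fin r) (Fin k) ℝ :=
  (Matrix.diagonal fun a : Fin r => √(σ (Fin.castLE (le_min hrd hrk) a))) *
    (V.submatrix id (Fin.castLE hrk))ᵀ

/-! ### The linear model, the full gradient and preconditioned gradient descent -/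

/-- The data matrix, whose rows are the data points. -/
def dataMatrix {N d : ℕ} (x : Fin N → EuclideanSpace ℝ (Fin d)) : Matrix (Fin N) (Fin d) ℝ :=
  Matrix.of fun i j => x i j

/-- The label matrix `Y = X (W + Δ)` of the noiseless linear model. -/
def labelMatrix {N d k : ℕ} (X : Matrix (Fin N) (Fin d) ℝ) (W Δ : Matrix (Fin d) (Fin k) ℝ) :
    Matrix (Fin N) (Fin k) ℝ :=
  X * (W + Δ)

/-- The sample second-moment matrix `Σ̂ = (1/N) Xᵀ X`. -/
def empiricalCovariance {N d : ℕ} (X : Matrix (Fin N) (Fin d) ℝ) : Matrix (Fin d) (Fin d) ℝ :=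
  (1 / (N : ℝ)) • (Xᵀ * X)

/-- The gradient `∇L(W) = (1/N) Xᵀ (X W - Y)` of `L(W) = (1/(2N)) ‖X W - Y‖_F²`. -/
def fullGradient {N d k : ℕ} (X : Matrix (Fin N) (Fin d) ℝ) (Y : Matrix (Fin N) (Fin k) ℝ)
    (W : Matrix (Fin d) (Fin k) ℝ) : Matrix (Fin d) (Fin k) ℝ :=
  (1 / (N : ℝ)) • (Xᵀ * (X * W - Y))

/-- The preconditioned gradient descent iterates `(A_t, B_t)` with step size `η`,
started at `(A₀, B₀)`. -/
def precGD {N d k r : ℕ} (X : Matrix (Fin N) (Fin d) ℝ) (Y : Matrix (Fin N) (Fin k) ℝ)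
    (W : Matrix (Fin d) (Fin k) ℝ) (η : ℝ)
    (A₀ : Matrix (Fin d) (Fin r) ℝ) (B₀ : Matrix (Fin r) (Fin k) ℝ) :
    ℕ → Matrix (Fin d) (Fin r) ℝ × Matrix (Fin r) (Fin k) ℝ
  | 0 => (A₀, B₀)
  | t + 1 =>
    let A := (precGD X Y W η A₀ B₀ t).1
    let B := (precGD X Y W η A₀ B₀ t).2
    (A - (η / (N : ℝ)) • (Xᵀ * (X * (W + A * B) - Y) * Bᵀ * pinv (B * Bᵀ)),
     B - (η / (N : ℝ)) • (pinv (Aᵀ * A) * Aᵀ * Xᵀ * (X * (W + A * B) - Y)))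

/-! ### The data distribution -/

/-- `μ` is a centered, isotropic, sub-Gaussian law on `ℝ^d` with sub-Gaussian (`ψ₂`) norm at
most `K`, that is, `E exp(⟨u, x⟩² / K²) ≤ 2` for every unit vector `u`. -/
structure IsIsotropicSubGaussian {d : ℕ} (μ : Measure (EuclideanSpace ℝ (Fin d))) (K : ℝ) :
    Prop where
  isProbabilityMeasure : IsProbabilityMeasure μ
  centered : ∀ i, ∫ x, x i ∂μ = 0
  isotropic : ∀ i j, ∫ x, x i * x j ∂μ = if i = j then 1 else 0
  subGaussian : ∀ u : EuclideanSpace ℝ (Fin d), ‖u‖ = 1 →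
    ∫⁻ x, ENNReal.ofReal (Real.exp (⟪u, x⟫ ^ 2 / K ^ 2)) ∂μ ≤ 2

end LoRA

end

namespace LoRA

/-! ### Norm inequalities -/

/-! Write `H` for the sample covariance, `R = A B - Δ` and `λ` for the smallest nonzero singular
value of `Δ`. Randomness enters only through `‖H - 1‖ ≤ ε`; on that event everything is
deterministic, so one event serves every SVD and every `t`.

Since `Bᵀ (B Bᵀ)† = B†` and `(Aᵀ A)† Aᵀ = A†`, a step is `A - η H R B†`, `B - η A† H R`, and the new
residual is `R - η H R B† B - η A A† H R + η² H R B† A† H R`. Two facts make this contract at a rate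
free of `κ`. First, `R B† B = R` (`residual_mul_pinv_mul`), so the first-order terms are `-η (1 + Q)
R` up to `ε`, with `Q = A A†` an orthogonal projection. Second, `R B† A†` has norm at most 1
(`opNorm_residual_mul_pinv_le`): for `z = B† A† v` one has `‖R z‖ ≤ (λ/2) ‖z‖ ≤ ‖A B z‖ = ‖Q v‖`, so
the possibly huge pseudo-inverses cancel against the smallness of `R`. The new residual is then `T
R` with `‖T‖ ≤ 1 - η/2` (`frobeniusNorm_step_le`).

Both facts rest on `‖R‖_F ≤ λ/2`, which the contraction preserves, and on `IsAligned`: `ker Δ ⊆ ker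
B`, while the row space of `A` and the column space of `B` stay in a fixed subspace `S` with `dim S
≤ rank Δ`. This invariant handles `r > rank Δ`, where the Gram matrices are singular. Spectral
initialization provides both: `A₀ B₀ = H Δ` because `rank (H Δ) ≤ r`, so the initial error `(H - 1)
Δ` is at most `ε √r* λ₁ ≤ λ/2` in Frobenius norm.

The event has high probability by a net argument on the sphere and a Bernstein bound for `∑ (⟨u,
xᵢ⟩² - 1)` at each net point. -/

/-- The Euclidean norm of a vector. -/
noncomputable def vecNorm {n : ℕ} (v : Fin n → ℝ) : ℝ := ‖WithLp.toLp 2 v‖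

theorem vecNorm_nonneg {n : ℕ} (v : Fin n → ℝ) : 0 ≤ vecNorm v := norm_nonneg _

theorem vecNorm_sq {n : ℕ} (v : Fin n → ℝ) : vecNorm v ^ 2 = v ⬝ᵥ v := by
  rw [vecNorm, EuclideanSpace.real_norm_sq_eq]
  simp [dotProduct, sq]

theorem eq_zero_of_vecNorm_le_zero {n : ℕ} {v : Fin n → ℝ} (h : vecNorm v ≤ 0) : v = 0 := by
  have h1 : vecNorm v = 0 := le_antisymm h (vecNorm_nonneg v)
  have h2 := vecNorm_sq v
  rw [h1] at h2
  exact dotProduct_self_eq_zero.1 (by simpa using h2.symm)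

theorem vecNorm_le_vecNorm_add_vecNorm_sub {n : ℕ} (v w : Fin n → ℝ) :
    vecNorm v ≤ vecNorm w + vecNorm (w - v) := by
  have := norm_sub_norm_le (WithLp.toLp 2 v) (WithLp.toLp 2 w)
  rw [norm_sub_rev, ← WithLp.toLp_sub] at this
  unfold vecNorm
  linarith

theorem vecNorm_mulVec_le_opNorm {n : ℕ} (M : Matrix (Fin n) (Fin n) ℝ) (v : Fin n → ℝ) :
    vecNorm (M *ᵥ v) ≤ opNorm M * vecNorm v := by
  have := (Matrix.toEuclideanCLM (n := Fin n) (𝕜 := ℝ) M).le_opNorm (WithLp.toLp 2 v)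
  rwa [Matrix.toEuclideanCLM_toLp] at this

theorem opNorm_le_of_vecNorm_le {n : ℕ} {M : Matrix (Fin n) (Fin n) ℝ} {c : ℝ} (hc : 0 ≤ c)
    (h : ∀ v, vecNorm (M *ᵥ v) ≤ c * vecNorm v) : opNorm M ≤ c := by
  refine ContinuousLinearMap.opNorm_le_bound _ hc fun v => ?_
  have := h v.ofLp
  rwa [vecNorm, ← Matrix.toEuclideanCLM_toLp] at this

theorem opNorm_nonneg {n : ℕ} (M : Matrix (Fin n) (Fin n) ℝ) : 0 ≤ opNorm M := norm_nonneg _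

theorem opNorm_one_le {n : ℕ} : opNorm (1 : Matrix (Fin n) (Fin n) ℝ) ≤ 1 :=
  opNorm_le_of_vecNorm_le zero_le_one fun v => by simp

theorem opNorm_mul_le {n : ℕ} (M N : Matrix (Fin n) (Fin n) ℝ) :
    opNorm (M * N) ≤ opNorm M * opNorm N := by
  simpa only [opNorm, map_mul] using norm_mul_le (Matrix.toEuclideanCLM (n := Fin n) (𝕜 := ℝ) M)
    (Matrix.toEuclideanCLM (n := Fin n) (𝕜 := ℝ) N)

theorem opNorm_add_le {n : ℕ} (M N : Matrix (Fin n) (Fin n) ℝ) :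
    opNorm (M + N) ≤ opNorm M + opNorm N := by
  simpa only [opNorm, map_add] using norm_add_le (Matrix.toEuclideanCLM (n := Fin n) (𝕜 := ℝ) M)
    (Matrix.toEuclideanCLM (n := Fin n) (𝕜 := ℝ) N)

theorem opNorm_smul {n : ℕ} (a : ℝ) (M : Matrix (Fin n) (Fin n) ℝ) :
    opNorm (a • M) = |a| * opNorm M := by
  simp only [opNorm, map_smul, norm_smul, Real.norm_eq_abs]

/-- Twice a symmetric idempotent minus the identity is orthogonal. -/
theorem opNorm_one_sub_two_smul_le {n : ℕ} {Q : Matrix (Fin n) (Fin n) ℝ} (hs : Qᵀ = Q)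
    (hi : Q * Q = Q) : opNorm (1 - (2 : ℝ) • Q) ≤ 1 := by
  refine opNorm_le_of_vecNorm_le zero_le_one fun v => ?_
  have h : (1 - (2 : ℝ) • Q)ᵀ * (1 - (2 : ℝ) • Q) = 1 := by
    rw [Matrix.transpose_sub, Matrix.transpose_smul, hs, Matrix.transpose_one]
    simp only [Matrix.sub_mul, Matrix.mul_sub, Matrix.one_mul, Matrix.mul_one, Matrix.smul_mul,
      Matrix.mul_smul, hi]
    module
  have h2 : vecNorm ((1 - (2 : ℝ) • Q) *ᵥ v) ^ 2 = vecNorm v ^ 2 := by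
    rw [vecNorm_sq, vecNorm_sq, Matrix.dotProduct_mulVec, Matrix.vecMul_mulVec, h,
      Matrix.vecMul_one]
  rw [one_mul]
  exact le_of_sq_le_sq h2.le (vecNorm_nonneg v)

section Frobenius

open scoped Matrix.Norms.Frobenius

theorem frobeniusNorm_nonneg {m n : ℕ} (M : Matrix (Fin m) (Fin n) ℝ) : 0 ≤ frobeniusNorm M :=
  norm_nonneg M

theorem vecNorm_mulVec_le_frobeniusNorm {m n : ℕ} (M : Matrix (Fin m) (Fin n) ℝ)
    (v : Fin n → ℝ) : vecNorm (M *ᵥ v) ≤ frobeniusNorm M * vecNorm v := by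
  have := Matrix.frobenius_norm_mul M (Matrix.replicateCol Unit v)
  rwa [← Matrix.replicateCol_mulVec, Matrix.frobenius_norm_replicateCol,
    Matrix.frobenius_norm_replicateCol] at this

theorem frobeniusNorm_sq {m n : ℕ} (M : Matrix (Fin m) (Fin n) ℝ) :
    frobeniusNorm M ^ 2 = ∑ j, vecNorm (M.col j) ^ 2 := by
  have h0 : 0 ≤ ∑ i, ∑ j, ‖M i j‖ ^ (2 : ℝ) := by positivity
  rw [frobeniusNorm, Matrix.frobenius_norm_def, ← Real.sqrt_eq_rpow, Real.sq_sqrt h0,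
    Finset.sum_comm]
  refine Finset.sum_congr rfl fun j _ => ?_
  rw [vecNorm_sq]
  simp [dotProduct, sq]

theorem frobeniusNorm_mul_le {m n : ℕ} (T : Matrix (Fin m) (Fin m) ℝ)
    (M : Matrix (Fin m) (Fin n) ℝ) : frobeniusNorm (T * M) ≤ opNorm T * frobeniusNorm M := by
  refine le_of_sq_le_sq ?_ (mul_nonneg (opNorm_nonneg T) (frobeniusNorm_nonneg M))
  rw [mul_pow, frobeniusNorm_sq, frobeniusNorm_sq, Finset.mul_sum]
  refine Finset.sum_le_sum fun j _ => ?_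
  rw [← mul_pow]
  have h : (T * M).col j = T *ᵥ M.col j := by
    ext i
    simp [Matrix.mul_apply, Matrix.mulVec, dotProduct]
  rw [h]
  exact pow_le_pow_left₀ (vecNorm_nonneg _) (vecNorm_mulVec_le_opNorm T _) 2

end Frobenius

/-! ### Singular values -/

theorem finrank_range_toEuclideanLin {m n : ℕ} (M : Matrix (Fin m) (Fin n) ℝ) :
    Module.finrank ℝ (LinearMap.range (Matrix.toEuclideanLin M)) = M.rank := by
  rw [Matrix.toEuclideanLin, Matrix.toLpLin_eq_toLin, ← Matrix.rank_eq_finrank_range_toLin]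

theorem singularValue_rank_pos {m n : ℕ} {M : Matrix (Fin m) (Fin n) ℝ} (h : 1 ≤ M.rank) :
    0 < singularValue M M.rank := by
  rw [singularValue, LinearMap.singularValues_pos_iff_lt_finrank_range,
    finrank_range_toEuclideanLin]
  omega

/-- The smallest nonzero singular value bounds a matrix from below on the orthogonal complement
of its kernel. -/
theorem singularValue_rank_mul_vecNorm_le {m n : ℕ} (M : Matrix (Fin m) (Fin n) ℝ)
    {z : Fin n → ℝ} (hz : ∀ w, M *ᵥ w = 0 → z ⬝ᵥ w = 0) :
    singularValue M M.rank * vecNorm z ≤ vecNorm (M *ᵥ z) := by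
  set T := Matrix.toEuclideanLin M with hT
  have hn : Module.finrank ℝ (EuclideanSpace ℝ (Fin n)) = n := by simp
  set hs := T.isSymmetric_adjoint_comp_self
  set b := hs.eigenvectorBasis hn
  set y : EuclideanSpace ℝ (Fin n) := WithLp.toLp 2 z with hy
  -- The comparison is made coordinatewise in an eigenbasis of `T* T`. Indices are zero-based: for
  -- `i ≥ rank` the vector `b i` lies in the kernel, so `hz` kills the coordinate of `y`.
  have key : ∀ i, T.singularValues (M.rank - 1) ^ 2 * ⟪b i, y⟫ ^ 2
      ≤ T.singularValues i ^ 2 * ⟪b i, y⟫ ^ 2 := by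
    intro i
    by_cases hi : (i : ℕ) < M.rank
    · gcongr
      · exact T.singularValues_nonneg _
      · exact T.singularValues_antitone (by omega)
    · have h0 : T.singularValues i = 0 := by
        rw [LinearMap.singularValues_eq_zero_iff_le_finrank_range, finrank_range_toEuclideanLin]
        omega
      have h1 : T.adjoint (T (b i)) = 0 := by
        have := hs.apply_eigenvectorBasis hn i
        rw [← T.sq_singularValues_fin hn i, h0] at this
        rw [← LinearMap.comp_apply, this]
        norm_num
      have h2 : T (b i) = 0 := by
        rw [← inner_self_eq_zero (𝕜 := ℝ), ← LinearMap.adjoint_inner_left, h1, inner_zero_left]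
      have h3 : z ⬝ᵥ (b i).ofLp = 0 := by
        apply hz
        have := congrArg WithLp.ofLp h2
        simpa [hT, Matrix.toLpLin_apply] using this
      have h4 : ⟪b i, y⟫ = 0 := by
        rw [EuclideanSpace.inner_eq_star_dotProduct]
        simpa [hy] using h3
      simp [h4]
  have hsum : ‖T y‖ ^ 2 = ∑ i : Fin n, T.singularValues i ^ 2 * ⟪b i, y⟫ ^ 2 := by
    rw [← real_inner_self_eq_norm_sq, ← LinearMap.adjoint_inner_left,
      ← b.sum_inner_mul_inner]
    refine Finset.sum_congr rfl fun i _ => ?_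
    have h1 : ⟪T.adjoint (T y), b i⟫ = T.singularValues i ^ 2 * ⟪y, b i⟫ := by
      have h2 := hs y (b i)
      rw [hs.apply_eigenvectorBasis hn i] at h2
      rw [← LinearMap.comp_apply, h2, T.sq_singularValues_fin hn i]
      rw [inner_smul_right]
      rfl
    rw [h1, real_inner_comm]
    ring
  have hfin : (singularValue M M.rank * vecNorm z) ^ 2 ≤ vecNorm (M *ᵥ z) ^ 2 := by
    have h1 : vecNorm (M *ᵥ z) = ‖T y‖ := by rw [hT, hy, Matrix.toLpLin_toLp]; rfl
    have h2 : vecNorm z ^ 2 = ∑ i, ⟪b i, y⟫ ^ 2 := by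
      rw [vecNorm, ← b.sum_sq_norm_inner_right]
      simp [hy]
    rw [h1, hsum, mul_pow, h2, Finset.mul_sum]
    exact Finset.sum_le_sum fun i _ => key i
  exact le_of_sq_le_sq hfin (vecNorm_nonneg _)

theorem frobeniusNorm_le_sqrt_rank_mul {m n : ℕ} (M : Matrix (Fin m) (Fin n) ℝ) :
    frobeniusNorm M ≤ √(M.rank : ℝ) * singularValue M 1 := by
  set T := Matrix.toEuclideanLin M with hT
  have hn : Module.finrank ℝ (EuclideanSpace ℝ (Fin n)) = n := by simp
  have h0 : 0 ≤ singularValue M 1 := T.singularValues_nonneg _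
  refine le_of_sq_le_sq ?_ (by positivity)
  have h1 : frobeniusNorm M ^ 2 = LinearMap.trace ℝ _ (T.adjoint ∘ₗ T) := by
    rw [LinearMap.trace_eq_sum_inner _ (EuclideanSpace.basisFun (Fin n) ℝ), frobeniusNorm_sq]
    refine Finset.sum_congr rfl fun j _ => ?_
    rw [LinearMap.comp_apply, LinearMap.adjoint_inner_right, real_inner_self_eq_norm_sq, hT,
      EuclideanSpace.basisFun_apply, Matrix.toLpLin_apply]
    simp [vecNorm]
  have h2 : LinearMap.trace ℝ _ (T.adjoint ∘ₗ T) = ∑ i : Fin n, T.singularValues i ^ 2 := by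
    rw [T.isSymmetric_adjoint_comp_self.trace_eq_sum_eigenvalues hn]
    simp [T.sq_singularValues_fin hn]
  rw [h1, h2, mul_pow, Real.sq_sqrt (Nat.cast_nonneg _), Fin.sum_univ_eq_sum_range
    (fun i => T.singularValues i ^ 2), ← finrank_range_toEuclideanLin, ← hT,
    ← LinearMap.card_support_singularValues, ← nsmul_eq_mul]
  calc ∑ i ∈ Finset.range n, T.singularValues i ^ 2
      ≤ ∑ i ∈ T.singularValues.support, T.singularValues i ^ 2 :=
by
        rw [← Finset.sum_filter_ne_zero]
        refine Finset.sum_le_sum_of_subset_of_nonneg (fun i hi => ?_) fun i _ _ => sq_nonneg _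
        rw [Finsupp.mem_support_iff]
        exact fun h => (Finset.mem_filter.1 hi).2 (by rw [h]; norm_num)
    _ ≤ _ := Finset.sum_le_card_nsmul _ _ _ fun i _ =>
        pow_le_pow_left₀ (T.singularValues_nonneg i) (T.singularValues_antitone (Nat.zero_le i)) 2

/-! ### Pseudo-inverses -/

namespace IsMoorePenrose

variable {m n : ℕ} {M : Matrix (Fin m) (Fin n) ℝ} {Z : Matrix (Fin n) (Fin m) ℝ}

theorem transpose (h : IsMoorePenrose M Z) : IsMoorePenrose Mᵀ Zᵀ where
  mul_mul_left := by rw [← Matrix.transpose_mul, ← Matrix.transpose_mul, ← Matrix.mul_assoc,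
    h.mul_mul_left]
  mul_mul_right := by rw [← Matrix.transpose_mul, ← Matrix.transpose_mul, ← Matrix.mul_assoc,
    h.mul_mul_right]
  symm_left := by rw [← Matrix.transpose_mul, h.symm_right, h.symm_right]
  symm_right := by rw [← Matrix.transpose_mul, h.symm_left, h.symm_left]

/-- Used to place the range of `M†` inside the row space of `M`. -/
theorem eq_transpose_mul (h : IsMoorePenrose M Z) : Z = Mᵀ * (Zᵀ * Z) := by
  rw [← Matrix.mul_assoc, ← Matrix.transpose_mul, h.symm_right, h.mul_mul_right]

theorem transpose_eq_mul (h : IsMoorePenrose M Z) : Zᵀ = M * (Z * Zᵀ) := by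
  simpa using h.transpose.eq_transpose_mul

end IsMoorePenrose

/-- By uniqueness `(Mᵀ M)† = M† (M†)ᵀ`, valid without any rank assumption. -/
theorem pinv_transpose_mul_self_mul {m n : ℕ} (M : Matrix (Fin m) (Fin n) ℝ) :
    pinv (Mᵀ * M) * Mᵀ = pinv M := by
  have hM := isMoorePenrose_pinv M
  have h1 : IsMoorePenrose (Mᵀ * M) (pinv M * (pinv M)ᵀ) := by
    have e1 : Mᵀ * M * (pinv M * (pinv M)ᵀ) = Mᵀ * (pinv M)ᵀ := by
      rw [Matrix.mul_assoc, ← hM.transpose_eq_mul]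
    have e2 : pinv M * (pinv M)ᵀ * (Mᵀ * M) = pinv M * M := by
      rw [← Matrix.mul_assoc, Matrix.mul_assoc (pinv M), ← Matrix.transpose_mul, hM.symm_left,
        ← Matrix.mul_assoc, hM.mul_mul_right]
    refine ⟨?_, ?_, ?_, ?_⟩
    · rw [e1, ← Matrix.mul_assoc, hM.transpose.mul_mul_left]
    · rw [e2, ← Matrix.mul_assoc, hM.mul_mul_right]
    · rw [e1, ← Matrix.transpose_mul, hM.symm_right, hM.symm_right]
    · rw [e2, hM.symm_right]
  rw [(isMoorePenrose_pinv (Mᵀ * M)).unique h1, Matrix.mul_assoc, ← Matrix.transpose_mul,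
    hM.symm_left, ← Matrix.mul_assoc, hM.mul_mul_right]

theorem mul_pinv_mul_transpose_self {m n : ℕ} (M : Matrix (Fin m) (Fin n) ℝ) :
    Mᵀ * pinv (M * Mᵀ) = pinv M := by
  have h1 := pinv_transpose_mul_self_mul Mᵀ
  rw [Matrix.transpose_transpose] at h1
  have h2 : (pinv (M * Mᵀ))ᵀ = pinv (M * Mᵀ) := by
    have h := (isMoorePenrose_pinv (M * Mᵀ)).transpose
    rw [Matrix.transpose_mul, Matrix.transpose_transpose] at h
    exact h.unique (isMoorePenrose_pinv _)
  have h3 : pinv Mᵀ = (pinv M)ᵀ := (isMoorePenrose_pinv _).unique (isMoorePenrose_pinv M).transpose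
  rw [← Matrix.transpose_transpose (pinv M), ← h3, ← h1, Matrix.transpose_mul, h2]

/-! ### One step of preconditioned gradient descent -/

/-- The factors `A`, `B` act through the subspace `S`, and `B` vanishes on the kernel of `Δ`. -/
structure IsAligned {d k r : ℕ} (Δ : Matrix (Fin d) (Fin k) ℝ) (S : Submodule ℝ (Fin r → ℝ))
    (A : Matrix (Fin d) (Fin r) ℝ) (B : Matrix (Fin r) (Fin k) ℝ) : Prop where
  ker_le : ∀ z, Δ *ᵥ z = 0 → B *ᵥ z = 0
  left_mem : ∀ v, Aᵀ *ᵥ v ∈ S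
  right_mem : ∀ v, B *ᵥ v ∈ S

section Step

variable {d k r : ℕ} {Δ : Matrix (Fin d) (Fin k) ℝ} {S : Submodule ℝ (Fin r → ℝ)}
  {A : Matrix (Fin d) (Fin r) ℝ} {B : Matrix (Fin r) (Fin k) ℝ}

/-- The residual vanishes on `ker Δ`. The correction to `Aᵀ` factors through `(B†)ᵀ = B (⋯)` and the
correction to `B` through `A† = Aᵀ (⋯)`, so each factor only receives vectors that the other already
has in `S`. -/
theorem IsAligned.step (h : IsAligned Δ S A B) (H : Matrix (Fin d) (Fin d) ℝ) (η : ℝ) :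
    IsAligned Δ S (A - η • (H * (A * B - Δ) * pinv B)) (B - η • (pinv A * (H * (A * B - Δ)))) where
  ker_le z hz := by
    have h1 : (A * B - Δ) *ᵥ z = 0 := by
      rw [Matrix.sub_mulVec, ← Matrix.mulVec_mulVec, h.ker_le z hz, hz, Matrix.mulVec_zero,
        sub_zero]
    rw [Matrix.sub_mulVec, Matrix.smul_mulVec, ← Matrix.mulVec_mulVec, ← Matrix.mulVec_mulVec,
      h1, h.ker_le z hz, Matrix.mulVec_zero, Matrix.mulVec_zero, smul_zero, sub_zero]
  left_mem v := by
    rw [Matrix.transpose_sub, Matrix.transpose_smul, Matrix.transpose_mul, Matrix.sub_mulVec,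
      Matrix.smul_mulVec, (isMoorePenrose_pinv B).transpose_eq_mul, Matrix.mul_assoc,
      ← Matrix.mulVec_mulVec]
    exact S.sub_mem (h.left_mem v) (S.smul_mem η (h.right_mem _))
  right_mem v := by
    rw [Matrix.sub_mulVec, Matrix.smul_mulVec, (isMoorePenrose_pinv A).eq_transpose_mul,
      Matrix.mul_assoc, ← Matrix.mulVec_mulVec]
    exact S.sub_mem (h.right_mem v) (S.smul_mem η (h.left_mem _))

/-- The range of `B†` is orthogonal to `ker B`, hence to the smaller space `ker Δ`. -/
theorem IsAligned.singularValue_mul_vecNorm_pinv_le (h : IsAligned Δ S A B) (w : Fin r → ℝ) :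
    singularValue Δ Δ.rank * vecNorm (pinv B *ᵥ w) ≤ vecNorm (Δ *ᵥ (pinv B *ᵥ w)) := by
  refine singularValue_rank_mul_vecNorm_le Δ fun z hz => ?_
  rw [(isMoorePenrose_pinv B).eq_transpose_mul, ← Matrix.mulVec_mulVec, Matrix.mulVec_transpose,
    ← Matrix.dotProduct_mulVec, h.ker_le z hz, dotProduct_zero]

/-- If `A B` is close to `Δ`, it is bounded below on the orthogonal complement of `ker Δ`. -/
theorem vecNorm_le_of_frobeniusNorm_sub_le
    (hR : frobeniusNorm (A * B - Δ) ≤ singularValue Δ Δ.rank / 2) {z : Fin k → ℝ}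
    (hz : singularValue Δ Δ.rank * vecNorm z ≤ vecNorm (Δ *ᵥ z)) :
    singularValue Δ Δ.rank / 2 * vecNorm z ≤ vecNorm ((A * B) *ᵥ z) := by
  have h1 := vecNorm_le_vecNorm_add_vecNorm_sub (Δ *ᵥ z) ((A * B) *ᵥ z)
  rw [← Matrix.sub_mulVec] at h1
  have h2 := (vecNorm_mulVec_le_frobeniusNorm (A * B - Δ) z).trans
    (mul_le_mul_of_nonneg_right hR (vecNorm_nonneg z))
  linarith

/-- Closeness to `Δ` prevents `B` from losing rank. The projection `w₁` of `w` onto `(ker Δ)ᗮ` is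
still killed by `B`, yet `A B` is bounded below by `λ/2` there, so `w₁ = 0`. -/
theorem mulVec_eq_zero_of_frobeniusNorm_sub_le (hpos : 0 < singularValue Δ Δ.rank)
    (h : IsAligned Δ S A B) (hR : frobeniusNorm (A * B - Δ) ≤ singularValue Δ Δ.rank / 2)
    {w : Fin k → ℝ} (hw : B *ᵥ w = 0) : Δ *ᵥ w = 0 := by
  have hD := isMoorePenrose_pinv Δ
  set w₁ := (pinv Δ * Δ) *ᵥ w with hw₁
  have h1 : Δ *ᵥ w₁ = Δ *ᵥ w := by
    rw [hw₁, Matrix.mulVec_mulVec, ← Matrix.mul_assoc, hD.mul_mul_left]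
  have h2 : B *ᵥ w₁ = 0 := by
    have h3 : B *ᵥ (w - w₁) = 0 := h.ker_le _ (by rw [Matrix.mulVec_sub, h1, sub_self])
    rw [Matrix.mulVec_sub, hw, zero_sub, neg_eq_zero] at h3
    exact h3
  have h3 : singularValue Δ Δ.rank * vecNorm w₁ ≤ vecNorm (Δ *ᵥ w₁) := by
    refine singularValue_rank_mul_vecNorm_le Δ fun z hz => ?_
    rw [hw₁, ← hD.symm_right, Matrix.mulVec_transpose, ← Matrix.dotProduct_mulVec,
      ← Matrix.mulVec_mulVec, hz, Matrix.mulVec_zero, dotProduct_zero]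
  have h4 := vecNorm_le_of_frobeniusNorm_sub_le hR h3
  rw [← Matrix.mulVec_mulVec, h2, Matrix.mulVec_zero] at h4
  have h5 : vecNorm (0 : Fin d → ℝ) = 0 := by simp [vecNorm]
  rw [h5] at h4
  have h6 : w₁ = 0 := eq_zero_of_vecNorm_le_zero (by nlinarith [vecNorm_nonneg w₁])
  rw [← h1, h6, Matrix.mulVec_zero]

theorem residual_mul_pinv_mul (hpos : 0 < singularValue Δ Δ.rank) (h : IsAligned Δ S A B)
    (hR : frobeniusNorm (A * B - Δ) ≤ singularValue Δ Δ.rank / 2) :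
    (A * B - Δ) * (pinv B * B) = A * B - Δ := by
  have hB : B * (pinv B * B) = B := by
    rw [← Matrix.mul_assoc, (isMoorePenrose_pinv B).mul_mul_left]
  have hD : Δ * (pinv B * B) = Δ := by
    refine Matrix.ext_of_mulVec_single fun i => ?_
    set v : Fin k → ℝ := Pi.single i 1
    have h1 : B *ᵥ ((pinv B * B) *ᵥ v - v) = 0 := by
      rw [Matrix.mulVec_sub, Matrix.mulVec_mulVec, hB, sub_self]
    have h2 := mulVec_eq_zero_of_frobeniusNorm_sub_le hpos h hR h1
    rw [Matrix.mulVec_sub, Matrix.mulVec_mulVec, sub_eq_zero] at h2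
    exact h2
  rw [Matrix.sub_mul, Matrix.mul_assoc, hB, hD]

/-- A dimension count: `ker B = ker Δ` gives `rank B = rank Δ ≥ dim S`, so the column space of `B`
is all of `S`. It contains the range of `A†`, and `B B†` is the identity on it. -/
theorem mul_pinv_mul_pinv (hpos : 0 < singularValue Δ Δ.rank) (h : IsAligned Δ S A B)
    (hS : Module.finrank ℝ S ≤ Δ.rank)
    (hR : frobeniusNorm (A * B - Δ) ≤ singularValue Δ Δ.rank / 2) :
    B * (pinv B * pinv A) = pinv A := by
  have hker : LinearMap.ker B.mulVecLin = LinearMap.ker Δ.mulVecLin := by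
    ext z
    simp only [LinearMap.mem_ker, Matrix.mulVecLin_apply]
    exact ⟨fun hz => mulVec_eq_zero_of_frobeniusNorm_sub_le hpos h hR hz, h.ker_le z⟩
  have hrank : B.rank = Δ.rank := by
    have h1 := B.mulVecLin.finrank_range_add_finrank_ker
    have h2 := Δ.mulVecLin.finrank_range_add_finrank_ker
    rw [hker] at h1
    unfold Matrix.rank
    omega
  have hrange : LinearMap.range B.mulVecLin = S := by
    refine Submodule.eq_of_le_of_finrank_le ?_ (hS.trans hrank.ge)
    rintro _ ⟨v, rfl⟩
    exact h.right_mem v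
  refine Matrix.ext_of_mulVec_single fun i => ?_
  have h1 : pinv A *ᵥ Pi.single i 1 ∈ S := by
    rw [(isMoorePenrose_pinv A).eq_transpose_mul, ← Matrix.mulVec_mulVec]
    exact h.left_mem _
  rw [← hrange] at h1
  obtain ⟨w, hw⟩ := h1
  rw [Matrix.mulVecLin_apply] at hw
  rw [← Matrix.mul_assoc, ← Matrix.mulVec_mulVec, ← hw, Matrix.mulVec_mulVec,
    (isMoorePenrose_pinv B).mul_mul_left]

theorem vecNorm_mul_pinv_mulVec_le (A : Matrix (Fin d) (Fin r) ℝ) (v : Fin d → ℝ) :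
    vecNorm ((A * pinv A) *ᵥ v) ≤ vecNorm v := by
  have hA := isMoorePenrose_pinv A
  have h1 : vecNorm ((A * pinv A) *ᵥ v) ^ 2 = v ⬝ᵥ ((A * pinv A) *ᵥ v) := by
    rw [vecNorm_sq, ← Matrix.dotProduct_transpose_mulVec, hA.symm_left, Matrix.mulVec_mulVec,
      ← Matrix.mul_assoc, hA.mul_mul_left]
  have h2 : v ⬝ᵥ ((A * pinv A) *ᵥ v) ≤ vecNorm v * vecNorm ((A * pinv A) *ᵥ v) := by
    have := real_inner_le_norm (WithLp.toLp 2 v) (WithLp.toLp 2 ((A * pinv A) *ᵥ v))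
    rw [EuclideanSpace.inner_toLp_toLp] at this
    simpa [vecNorm, dotProduct_comm] using this
  by_contra hlt
  push Not at hlt
  nlinarith [vecNorm_nonneg v, vecNorm_nonneg ((A * pinv A) *ᵥ v)]

/-- This controls the second-order term of the step: the factor `λ/2` bounding `R` from above also
bounds `A B` from below on the range of `B†`, so it cancels. -/
theorem opNorm_residual_mul_pinv_le (hpos : 0 < singularValue Δ Δ.rank)
    (h : IsAligned Δ S A B) (hS : Module.finrank ℝ S ≤ Δ.rank)
    (hR : frobeniusNorm (A * B - Δ) ≤ singularValue Δ Δ.rank / 2) :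
    opNorm ((A * B - Δ) * (pinv B * pinv A)) ≤ 1 := by
  refine opNorm_le_of_vecNorm_le zero_le_one fun v => ?_
  rw [one_mul, ← Matrix.mulVec_mulVec]
  set z := (pinv B * pinv A) *ᵥ v with hz
  have h1 : singularValue Δ Δ.rank * vecNorm z ≤ vecNorm (Δ *ᵥ z) := by
    rw [hz, ← Matrix.mulVec_mulVec]
    exact h.singularValue_mul_vecNorm_pinv_le _
  have h2 := vecNorm_le_of_frobeniusNorm_sub_le hR h1
  have h3 : (A * B) *ᵥ z = (A * pinv A) *ᵥ v := by
    rw [hz, Matrix.mulVec_mulVec, Matrix.mul_assoc, mul_pinv_mul_pinv hpos h hS hR]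
  rw [h3] at h2
  calc vecNorm ((A * B - Δ) *ᵥ z) ≤ frobeniusNorm (A * B - Δ) * vecNorm z :=
        vecNorm_mulVec_le_frobeniusNorm _ _
    _ ≤ singularValue Δ Δ.rank / 2 * vecNorm z :=
        mul_le_mul_of_nonneg_right hR (vecNorm_nonneg z)
    _ ≤ vecNorm v := h2.trans (vecNorm_mul_pinv_mulVec_le A v)

/-- The residual contracts at a rate independent of the conditioning of `Δ`. -/
theorem frobeniusNorm_step_le (hpos : 0 < singularValue Δ Δ.rank)
    (h : IsAligned Δ S A B) (hS : Module.finrank ℝ S ≤ Δ.rank)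
    (hR : frobeniusNorm (A * B - Δ) ≤ singularValue Δ Δ.rank / 2)
    {H : Matrix (Fin d) (Fin d) ℝ} {ε η : ℝ} (hH : opNorm (H - 1) ≤ ε) (hη : 0 < η)
    (hεη : η * (1 + ε) ^ 2 + 2 * ε ≤ 1 / 2) :
    frobeniusNorm ((A - η • (H * (A * B - Δ) * pinv B)) * (B - η • (pinv A * (H * (A * B - Δ))))
      - Δ) ≤ (1 - η / 2) * frobeniusNorm (A * B - Δ) := by
  have hε : 0 ≤ ε := (opNorm_nonneg _).trans hH
  have hη2 : η ≤ 1 / 2 := by nlinarith [mul_nonneg hη.le hε]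
  have hRP := residual_mul_pinv_mul hpos h hR
  have hM := opNorm_residual_mul_pinv_le hpos h hS hR
  have hA := isMoorePenrose_pinv A
  have e4 : A * B = (A * B - Δ) + Δ := (sub_add_cancel _ _).symm
  generalize A * B - Δ = R at *
  set Q := A * pinv A with hQ
  set M := R * (pinv B * pinv A) with hMdef
  set F := H - 1 with hF
  have hHF : H = 1 + F := by rw [hF, add_sub_cancel]
  have hQi : Q * Q = Q := by rw [hQ, ← Matrix.mul_assoc, hA.mul_mul_left]
  -- `(1 - η) 1 - η Q` is split as `(1 - 3η/2) 1 + (η/2) (1 - 2Q)`, where `1 - 2Q` is a reflection;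
  -- the triangle inequality then gives `1 - η` for it. The other two terms cost `η (2ε + η (1 +
  -- ε)²) ≤ η/2`.
  set T : Matrix (Fin d) (Fin d) ℝ := (1 - 3 * η / 2) • (1 : Matrix (Fin d) (Fin d) ℝ)
    + (η / 2) • (1 - (2 : ℝ) • Q) + (-η) • ((F + Q * F)) + (η ^ 2) • (H * M * H) with hT
  have key : (A - η • (H * R * pinv B)) * (B - η • (pinv A * (H * R))) - Δ = T * R := by
    have e1 : H * R * pinv B * B = H * R := by
      rw [Matrix.mul_assoc, Matrix.mul_assoc, hRP]
    have e2 : A * (pinv A * (H * R)) = R + F * R - R - F * R + Q * R + Q * F * R := by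
      rw [hHF, hQ]
      simp only [Matrix.mul_assoc, Matrix.add_mul, Matrix.one_mul, Matrix.mul_add]
      abel
    have e3 : H * R * pinv B * (pinv A * (H * R)) = H * M * H * R := by
      rw [hMdef]; simp only [Matrix.mul_assoc]
    have e5 : H * R = R + F * R := by rw [hHF, Matrix.add_mul, Matrix.one_mul]
    rw [Matrix.sub_mul, Matrix.mul_sub, Matrix.mul_sub, Matrix.smul_mul, Matrix.smul_mul,
      Matrix.mul_smul, Matrix.mul_smul, e1, e2, e3, e4, e5, hT]
    simp only [Matrix.add_mul, Matrix.sub_mul, Matrix.smul_mul, Matrix.one_mul]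
    module
  have hQn : opNorm Q ≤ 1 := opNorm_le_of_vecNorm_le zero_le_one fun v => by
    rw [one_mul]; exact vecNorm_mul_pinv_mulVec_le A v
  have hHn : opNorm H ≤ 1 + ε := by
    rw [hHF]; exact (opNorm_add_le _ _).trans (add_le_add opNorm_one_le hH)
  have hTn : opNorm T ≤ 1 - η / 2 := by
    have t1 : opNorm ((1 - 3 * η / 2) • (1 : Matrix (Fin d) (Fin d) ℝ)) ≤ 1 - 3 * η / 2 := by
      rw [opNorm_smul, abs_of_nonneg (by linarith)]
      exact mul_le_of_le_one_right (by linarith) opNorm_one_le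
    have t2 : opNorm ((η / 2) • (1 - (2 : ℝ) • Q)) ≤ η / 2 := by
      rw [opNorm_smul, abs_of_nonneg (by linarith)]
      exact mul_le_of_le_one_right (by linarith) (opNorm_one_sub_two_smul_le hA.symm_left hQi)
    have t3 : opNorm ((-η) • (F + Q * F)) ≤ η * (2 * ε) := by
      rw [opNorm_smul, abs_neg, abs_of_pos hη]
      refine mul_le_mul_of_nonneg_left ?_ hη.le
      have := mul_le_mul hQn hH (opNorm_nonneg _) zero_le_one
      linarith [opNorm_add_le F (Q * F), opNorm_mul_le Q F]
    have t4 : opNorm ((η ^ 2) • (H * M * H)) ≤ η ^ 2 * (1 + ε) ^ 2 := by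
      rw [opNorm_smul, abs_of_nonneg (sq_nonneg η)]
      refine mul_le_mul_of_nonneg_left ?_ (sq_nonneg η)
      calc opNorm (H * M * H) ≤ opNorm H * opNorm M * opNorm H :=
            (opNorm_mul_le _ _).trans
              (mul_le_mul_of_nonneg_right (opNorm_mul_le _ _) (opNorm_nonneg _))
        _ ≤ (1 + ε) * 1 * (1 + ε) := by
            have := opNorm_nonneg H
            have := opNorm_nonneg M
            gcongr
        _ = (1 + ε) ^ 2 := by ring
    have t5 := opNorm_add_le ((1 - 3 * η / 2) • (1 : Matrix (Fin d) (Fin d) ℝ)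
      + (η / 2) • (1 - (2 : ℝ) • Q) + (-η) • ((F + Q * F))) ((η ^ 2) • (H * M * H))
    have t6 := opNorm_add_le ((1 - 3 * η / 2) • (1 : Matrix (Fin d) (Fin d) ℝ)
      + (η / 2) • (1 - (2 : ℝ) • Q)) ((-η) • ((F + Q * F)))
    have t7 := opNorm_add_le ((1 - 3 * η / 2) • (1 : Matrix (Fin d) (Fin d) ℝ))
      ((η / 2) • (1 - (2 : ℝ) • Q))
    nlinarith [mul_le_mul_of_nonneg_left hεη hη.le]
  rw [key]
  exact (frobeniusNorm_mul_le T R).trans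
    (mul_le_mul_of_nonneg_right hTn (frobeniusNorm_nonneg R))

end Step

/-! ### The iteration -/

theorem smul_transpose_mul_residual {N d k : ℕ} (X : Matrix (Fin N) (Fin d) ℝ)
    (W Δ Z : Matrix (Fin d) (Fin k) ℝ) :
    (1 / (N : ℝ)) • (Xᵀ * (X * (W + Z) - labelMatrix X W Δ)) =
      empiricalCovariance X * (Z - Δ) := by
  rw [labelMatrix, empiricalCovariance, Matrix.smul_mul, ← Matrix.mul_sub, add_sub_add_left_eq_sub,
    Matrix.mul_assoc]

theorem neg_fullGradient_labelMatrix {N d k : ℕ} (X : Matrix (Fin N) (Fin d) ℝ)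
    (W Δ : Matrix (Fin d) (Fin k) ℝ) :
    -fullGradient X (labelMatrix X W Δ) W = empiricalCovariance X * Δ := by
  have h := smul_transpose_mul_residual X W Δ 0
  rw [add_zero] at h
  rw [fullGradient, h, zero_sub, Matrix.mul_neg, neg_neg]

theorem precGD_succ {N d k r : ℕ} (X : Matrix (Fin N) (Fin d) ℝ) (W Δ : Matrix (Fin d) (Fin k) ℝ)
    (η : ℝ) (A₀ : Matrix (Fin d) (Fin r) ℝ) (B₀ : Matrix (Fin r) (Fin k) ℝ) (t : ℕ) :
    precGD X (labelMatrix X W Δ) W η A₀ B₀ (t + 1) =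
      let A := (precGD X (labelMatrix X W Δ) W η A₀ B₀ t).1
      let B := (precGD X (labelMatrix X W Δ) W η A₀ B₀ t).2
      (A - η • (empiricalCovariance X * (A * B - Δ) * pinv B),
       B - η • (pinv A * (empiricalCovariance X * (A * B - Δ)))) := by
  simp only [precGD]
  set A := (precGD X (labelMatrix X W Δ) W η A₀ B₀ t).1
  set B := (precGD X (labelMatrix X W Δ) W η A₀ B₀ t).2
  rw [pinv_transpose_mul_self_mul, Matrix.mul_assoc _ Bᵀ, mul_pinv_mul_transpose_self,
    ← smul_transpose_mul_residual X W Δ (A * B), Matrix.mul_assoc (pinv A), Matrix.smul_mul,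
    Matrix.mul_smul, smul_smul, smul_smul, mul_one_div]

/-- Contraction keeps the residual below `λ/2`, so the one-step bound remains applicable along the
induction. -/
theorem precGD_converges {N d k r : ℕ} {X : Matrix (Fin N) (Fin d) ℝ}
    {W Δ : Matrix (Fin d) (Fin k) ℝ} {S : Submodule ℝ (Fin r → ℝ)}
    {A₀ : Matrix (Fin d) (Fin r) ℝ} {B₀ : Matrix (Fin r) (Fin k) ℝ} {ε η : ℝ}
    (hpos : 0 < singularValue Δ Δ.rank) (h₀ : IsAligned Δ S A₀ B₀)
    (hS : Module.finrank ℝ S ≤ Δ.rank)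
    (hR : frobeniusNorm (A₀ * B₀ - Δ) ≤ singularValue Δ Δ.rank / 2)
    (hH : opNorm (empiricalCovariance X - 1) ≤ ε) (hη : 0 < η)
    (hεη : η * (1 + ε) ^ 2 + 2 * ε ≤ 1 / 2) (t : ℕ) :
    frobeniusNorm ((precGD X (labelMatrix X W Δ) W η A₀ B₀ t).1 *
        (precGD X (labelMatrix X W Δ) W η A₀ B₀ t).2 - Δ)
      ≤ 1 / 2 * (1 - η / 2) ^ t * singularValue Δ Δ.rank := by
  have hε : 0 ≤ ε := (opNorm_nonneg _).trans hH
  have hη2 : η ≤ 1 / 2 := by nlinarith [mul_nonneg hη.le hε]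
  suffices h : IsAligned Δ S (precGD X (labelMatrix X W Δ) W η A₀ B₀ t).1
      (precGD X (labelMatrix X W Δ) W η A₀ B₀ t).2 ∧
      frobeniusNorm ((precGD X (labelMatrix X W Δ) W η A₀ B₀ t).1 *
        (precGD X (labelMatrix X W Δ) W η A₀ B₀ t).2 - Δ)
      ≤ 1 / 2 * (1 - η / 2) ^ t * singularValue Δ Δ.rank from h.2
  induction t with
  | zero => exact ⟨h₀, by simpa [precGD, div_eq_inv_mul] using hR⟩
  | succ t ih =>
    rw [precGD_succ]
    refine ⟨ih.1.step _ η, ?_⟩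
    have h1 : (1 - η / 2) ^ t ≤ 1 := pow_le_one₀ (by linarith) (by linarith)
    have h2 := frobeniusNorm_step_le hpos ih.1 hS (ih.2.trans (by nlinarith)) hH hη hεη
    refine h2.trans ?_
    rw [pow_succ]
    nlinarith [mul_le_mul_of_nonneg_left ih.2 (show 0 ≤ 1 - η / 2 by linarith)]

/-! ### Spectral initialization -/

section Init

variable {d k r : ℕ} {G : Matrix (Fin d) (Fin k) ℝ} {U : Matrix (Fin d) (Fin d) ℝ}
  {σ : Fin (min d k) → ℝ} {V : Matrix (Fin k) (Fin k) ℝ}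

/-- If `σ i ≠ 0`, monotonicity makes the leading block of size `i + 1` an invertible diagonal
matrix, forcing rank at least `i + 1`. -/
theorem IsSVD.eq_zero_of_rank_le (h : IsSVD G U σ V) {i : Fin (min d k)} (hi : G.rank ≤ i) :
    σ i = 0 := by
  by_contra hne
  have hU : Uᵀ * U = 1 := (Matrix.mem_orthogonalGroup_iff' (Fin d) ℝ).1 h.left_mem
  have hV : Vᵀ * V = 1 := (Matrix.mem_orthogonalGroup_iff' (Fin k) ℝ).1 h.right_mem
  have h1 : rectDiagonal σ = Uᵀ * G * V := by
    calc rectDiagonal σ = (Uᵀ * U) * rectDiagonal σ * (Vᵀ * V) := by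
          rw [hU, hV, Matrix.one_mul, Matrix.mul_one]
      _ = Uᵀ * (U * rectDiagonal σ * Vᵀ) * V := by simp only [Matrix.mul_assoc]
      _ = _ := by rw [← h.eq]
  have h2 : (rectDiagonal σ).rank ≤ G.rank := by
    rw [h1]
    exact (Matrix.rank_mul_le_left _ _).trans (Matrix.rank_mul_le_right _ _)
  have hle : (i : ℕ) + 1 ≤ min d k := i.2
  have h3 : ((rectDiagonal σ).submatrix
      (Fin.castLE (hle.trans (min_le_left d k))) (Fin.castLE (hle.trans (min_le_right d k)))) =
      Matrix.diagonal fun j => σ (Fin.castLE hle j) := by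
    ext a b
    by_cases hab : a = b
    · subst hab
      simp [rectDiagonal]
      rfl
    · have : (a : ℕ) ≠ b := fun h => hab (Fin.ext h)
      simp [rectDiagonal, hab, this]
  have h4 := Matrix.rank_submatrix_le (rectDiagonal σ)
    (Fin.castLE (hle.trans (min_le_left d k))) (Fin.castLE (hle.trans (min_le_right d k)))
  have h5 : ∀ j : Fin ((i : ℕ) + 1), σ (Fin.castLE hle j) ≠ 0 := fun j => by
    have h6 : σ i ≤ σ (Fin.castLE hle j) :=
      h.antitone (Fin.le_def.2 (Nat.lt_succ_iff.1 j.2))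
    have h7 := (h.nonneg i).lt_of_ne' hne
    exact (h7.trans_le h6).ne'
  rw [h3, Matrix.rank_diagonal] at h4
  simp only [ne_eq, h5, not_false_eq_true, Fintype.card_subtype_true, Fintype.card_fin] at h4
  omega

theorem IsSVD.spectralInit_mul (h : IsSVD G U σ V) (hrd : r ≤ d) (hrk : r ≤ k)
    (hr : G.rank ≤ r) : spectralInitA hrd hrk U σ * spectralInitB hrd hrk σ V = G := by
  set E : Matrix (Fin d) (Fin r) ℝ := (1 : Matrix (Fin d) (Fin d) ℝ).submatrix id (Fin.castLE hrd)
  set F : Matrix (Fin k) (Fin r) ℝ := (1 : Matrix (Fin k) (Fin k) ℝ).submatrix id (Fin.castLE hrk)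
  set s : Fin r → ℝ := fun a => σ (Fin.castLE (le_min hrd hrk) a) with hs
  have hUE : U.submatrix id (Fin.castLE hrd) = U * E := by
    ext a b
    simp [E, Matrix.mul_apply, Matrix.one_apply]
  have hVF : V.submatrix id (Fin.castLE hrk) = V * F := by
    ext a b
    simp [F, Matrix.mul_apply, Matrix.one_apply]
  have hrect : rectDiagonal σ = E * Matrix.diagonal s * Fᵀ := by
    ext a b
    rw [Matrix.mul_apply]
    simp only [Matrix.mul_diagonal, Matrix.transpose_apply, E, F, Matrix.submatrix_apply, id,
      Matrix.one_apply, rectDiagonal, Matrix.of_apply]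
    by_cases har : (a : ℕ) < r
    · rw [Finset.sum_eq_single (⟨a, har⟩ : Fin r)]
      · by_cases hab : (a : ℕ) = b
        · have : b = Fin.castLE hrk ⟨a, har⟩ := Fin.ext hab.symm
          subst this
          simp [hs]
        · have : (b : ℕ) ≠ a := fun h => hab h.symm
          simp [hab, this, Fin.ext_iff]
      · intro c _ hc
        have : a ≠ Fin.castLE hrd c := fun h => hc (Fin.ext (congrArg Fin.val h).symm)
        simp [this]
      · simp
    · rw [Finset.sum_eq_zero]
      · split_ifs with hab
        · exact h.eq_zero_of_rank_le (by simp only; omega)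
        · rfl
      · intro c _
        have : a ≠ Fin.castLE hrd c := fun h => har (by rw [h]; exact c.2)
        simp [this]
  have hdiag : Matrix.diagonal s =
      (Matrix.diagonal fun a => √(s a)) * Matrix.diagonal fun a => √(s a) := by
    rw [Matrix.diagonal_mul_diagonal]
    congr 1; funext a
    exact (Real.mul_self_sqrt (h.nonneg _)).symm
  rw [spectralInitA, spectralInitB, hUE, hVF, Matrix.transpose_mul]
  conv_rhs => rw [h.eq, hrect, hdiag]
  simp only [Matrix.mul_assoc]
  rfl

theorem IsSVD.finrank_range_sqrt_le (h : IsSVD G U σ V) (hrd : r ≤ d) (hrk : r ≤ k) :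
    Module.finrank ℝ (LinearMap.range
      (Matrix.diagonal fun a : Fin r => √(σ (Fin.castLE (le_min hrd hrk) a))).mulVecLin)
      ≤ G.rank := by
  change Matrix.rank _ ≤ _
  rw [Matrix.rank_diagonal]
  have h1 : ∀ a : {a : Fin r // √(σ (Fin.castLE (le_min hrd hrk) a)) ≠ 0}, (a : ℕ) < G.rank := by
    rintro ⟨a, ha⟩
    by_contra hlt
    exact ha (by rw [h.eq_zero_of_rank_le (by simpa using hlt), Real.sqrt_zero])
  simpa using Fintype.card_le_of_injective
    (fun a : {a : Fin r // √(σ (Fin.castLE (le_min hrd hrk) a)) ≠ 0} =>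
      (⟨(a : Fin r), h1 a⟩ : Fin G.rank))
    fun a b hab => Subtype.ext (Fin.ext (by simpa using hab))

theorem IsSVD.isAligned_spectralInit (h : IsSVD G U σ V) (hrd : r ≤ d) (hrk : r ≤ k)
    (hr : G.rank ≤ r) {Δ : Matrix (Fin d) (Fin k) ℝ} (hker : ∀ z, Δ *ᵥ z = 0 → G *ᵥ z = 0) :
    IsAligned Δ (LinearMap.range
      (Matrix.diagonal fun a : Fin r => √(σ (Fin.castLE (le_min hrd hrk) a))).mulVecLin)
      (spectralInitA hrd hrk U σ) (spectralInitB hrd hrk σ V) where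
  left_mem v := by
    rw [spectralInitA, Matrix.transpose_mul, Matrix.diagonal_transpose, ← Matrix.mulVec_mulVec]
    exact ⟨_, rfl⟩
  right_mem v := by
    rw [spectralInitB, ← Matrix.mulVec_mulVec]
    exact ⟨_, rfl⟩
  ker_le z hz := by
    have h1 := hker z hz
    rw [← h.spectralInit_mul hrd hrk hr, ← Matrix.mulVec_mulVec] at h1
    have hU : Uᵀ * U = 1 := (Matrix.mem_orthogonalGroup_iff' (Fin d) ℝ).1 h.left_mem
    have hUr : (U.submatrix id (Fin.castLE hrd))ᵀ * U.submatrix id (Fin.castLE hrd) = 1 := by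
      ext a b
      have := congrFun (congrFun hU (Fin.castLE hrd a)) (Fin.castLE hrd b)
      simpa [Matrix.mul_apply, Matrix.one_apply] using this
    have h2 := congrArg (fun v => (U.submatrix id (Fin.castLE hrd))ᵀ *ᵥ v) h1
    simp only [Matrix.mulVec_zero] at h2
    rw [spectralInitA, Matrix.mulVec_mulVec, ← Matrix.mul_assoc, hUr, Matrix.one_mul] at h2
    ext a
    have h3 := congrFun h2 a
    rw [Matrix.mulVec_diagonal, Pi.zero_apply, mul_eq_zero] at h3
    -- Either the singular value is zero, and then so is that row of `B₀`, or it can be cancelled.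
    rcases h3 with h3 | h3
    · rw [spectralInitB, ← Matrix.mulVec_mulVec, Matrix.mulVec_diagonal, h3, zero_mul]
      rfl
    · exact h3

end Init

/-- Convergence on the event that the sample covariance is close to the identity. -/
theorem precGD_spectralInit_converges {N d k r : ℕ} {X : Matrix (Fin N) (Fin d) ℝ}
    {W Δ : Matrix (Fin d) (Fin k) ℝ} {ε η : ℝ} (hrd : r ≤ d) (hrk : r ≤ k) (hrank : 1 ≤ Δ.rank)
    (hr : Δ.rank ≤ r) (hε : ε ≤ 1 / (2 * √(Δ.rank : ℝ) * conditionNumber Δ))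
    (hη : η ∈ Set.Ioo 0 ((1 / 2 - 2 * ε) / (1 + ε) ^ 2))
    (hH : opNorm (empiricalCovariance X - 1) ≤ ε)
    {U : Matrix (Fin d) (Fin d) ℝ} {σ : Fin (min d k) → ℝ} {V : Matrix (Fin k) (Fin k) ℝ}
    (h : IsSVD (-fullGradient X (labelMatrix X W Δ) W) U σ V) (t : ℕ) :
    frobeniusNorm
        ((precGD X (labelMatrix X W Δ) W η (spectralInitA hrd hrk U σ)
            (spectralInitB hrd hrk σ V) t).1 *
          (precGD X (labelMatrix X W Δ) W η (spectralInitA hrd hrk U σ)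
            (spectralInitB hrd hrk σ V) t).2 - Δ)
      ≤ 1 / 2 * (1 - η / 2) ^ t * singularValue Δ Δ.rank := by
  rw [neg_fullGradient_labelMatrix] at h
  have hε0 : 0 ≤ ε := (opNorm_nonneg _).trans hH
  have hpos := singularValue_rank_pos hrank
  have hG : (empiricalCovariance X * Δ).rank ≤ Δ.rank := Matrix.rank_mul_le_right _ _
  refine precGD_converges hpos
    (h.isAligned_spectralInit hrd hrk (hG.trans hr) fun z hz => by
      rw [← Matrix.mulVec_mulVec, hz, Matrix.mulVec_zero])
    ((h.finrank_range_sqrt_le hrd hrk).trans hG) ?_ hH hη.1 ?_ t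
  · rw [h.spectralInit_mul hrd hrk (hG.trans hr)]
    have h1 : empiricalCovariance X * Δ - Δ = (empiricalCovariance X - 1) * Δ := by
      rw [Matrix.sub_mul, Matrix.one_mul]
    have hsq : 0 < √(Δ.rank : ℝ) := Real.sqrt_pos.2 (by exact_mod_cast hrank)
    have h1pos : 0 < singularValue Δ 1 :=
      hpos.trans_le (LinearMap.singularValues_antitone _ (Nat.sub_le_sub_right hrank 1))
    have hden : 0 < 2 * √(Δ.rank : ℝ) * conditionNumber Δ :=
      mul_pos (by positivity) (div_pos h1pos hpos)
    rw [le_div_iff₀ hden, conditionNumber] at hε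
    calc frobeniusNorm (empiricalCovariance X * Δ - Δ)
        ≤ ε * (√(Δ.rank : ℝ) * singularValue Δ 1) := by
          rw [h1]
          exact (frobeniusNorm_mul_le _ _).trans
            (mul_le_mul hH (frobeniusNorm_le_sqrt_rank_mul Δ) (frobeniusNorm_nonneg _) hε0)
      _ = ε * (2 * √(Δ.rank : ℝ) * (singularValue Δ 1 / singularValue Δ Δ.rank))
            * (singularValue Δ Δ.rank / 2) := by
          field_simp
      _ ≤ 1 * (singularValue Δ Δ.rank / 2) :=
          mul_le_mul_of_nonneg_right hε (by positivity)
      _ = _ := one_mul _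
  · have := (lt_div_iff₀ (by positivity)).1 hη.2
    linarith

/-! ### Nets and quadratic forms -/

/-- The unit sphere of `ℝ^d` has a `1/2`-net with at most `5 ^ d` points. -/
theorem exists_sphere_net (d : ℕ) : ∃ s : Finset (EuclideanSpace ℝ (Fin d)), s.card ≤ 5 ^ d ∧
    (∀ y ∈ s, ‖y‖ = 1) ∧ ∀ x : EuclideanSpace ℝ (Fin d), ‖x‖ = 1 →
      ∃ y ∈ s, ‖x - y‖ ≤ 1 / 2 := by
  classical
  let p : Finset (EuclideanSpace ℝ (Fin d)) → Prop := fun s =>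
    (∀ y ∈ s, ‖y‖ = 1) ∧ ∀ x ∈ s, ∀ y ∈ s, x ≠ y → 1 / 2 ≤ ‖x - y‖
  have hcard : ∀ s, p s → s.card ≤ 5 ^ d := by
    intro s hs
    -- Doubling turns a `1/2`-separated set on the unit sphere into a `1`-separated set in the ball
    -- of radius 2, the normalization of `Besicovitch.card_le_of_separated`.
    have hinj : Function.Injective fun y : EuclideanSpace ℝ (Fin d) => (2 : ℝ) • y :=
      smul_right_injective _ two_ne_zero
    rw [← Finset.card_image_of_injective s hinj]
    have h := Besicovitch.card_le_of_separated (s.image fun y => (2 : ℝ) • y) ?_ ?_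
    · simpa using h
    · intro c hc
      obtain ⟨y, hy, rfl⟩ := Finset.mem_image.1 hc
      simp [norm_smul, hs.1 y hy]
    · intro c hc e he hne
      obtain ⟨y, hy, rfl⟩ := Finset.mem_image.1 hc
      obtain ⟨z, hz, rfl⟩ := Finset.mem_image.1 he
      have := hs.2 y hy z hz fun h => hne (by rw [h])
      rw [← smul_sub, norm_smul, Real.norm_ofNat]
      linarith
  -- A separated set of maximal size is a net: an uncovered point could be added to it.
  let q : ℕ → Prop := fun n => ∃ s, p s ∧ s.card = n
  have hq0 : q 0 := ⟨∅, by simp [p], rfl⟩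
  obtain ⟨s, hs, hsn⟩ := Nat.findGreatest_spec (P := q) (Nat.zero_le (5 ^ d)) hq0
  refine ⟨s, hcard s hs, hs.1, fun x hx => ?_⟩
  by_contra! hcov
  have hxs : x ∉ s := fun h => by
    have := hcov x h
    rw [sub_self, norm_zero] at this
    linarith
  have hp : p (insert x s) := by
    refine ⟨fun y hy => ?_, fun y hy z hz hne => ?_⟩
    · rcases Finset.mem_insert.1 hy with rfl | hy
      exacts [hx, hs.1 y hy]
    · rcases Finset.mem_insert.1 hy with hyx | hys <;>
        rcases Finset.mem_insert.1 hz with hzx | hzs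
      · exact absurd (hyx.trans hzx.symm) hne
      · rw [hyx]; exact (hcov z hzs).le
      · rw [hzx, norm_sub_rev]; exact (hcov y hys).le
      · exact hs.2 y hys z hzs hne
  have h1 := Nat.le_findGreatest (P := q) (hcard _ hp) ⟨_, hp, rfl⟩
  rw [Finset.card_insert_of_notMem hxs, ← hsn] at h1
  omega

section Quadratic

variable {E : Type*} [NormedAddCommGroup E] [InnerProductSpace ℝ E] {T : E →L[ℝ] E}

/-- Polarization against the multiple `y` of `T x` having the norm of `x`, followed by the
parallelogram law. -/
theorem norm_le_of_abs_inner_self_le (hT : ∀ x y, ⟪T x, y⟫ = ⟪x, T y⟫) {c : ℝ} (hc : 0 ≤ c)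
    (h : ∀ x, |⟪T x, x⟫| ≤ c * ‖x‖ ^ 2) : ‖T‖ ≤ c := by
  refine T.opNorm_le_bound hc fun x => ?_
  by_cases hTx : ‖T x‖ = 0
  · rw [hTx]; positivity
  have hTpos : 0 < ‖T x‖ := (norm_nonneg _).lt_of_ne' hTx
  have hx : 0 < ‖x‖ := norm_pos_iff.2 fun h0 => hTx (by rw [h0, map_zero, norm_zero])
  set y := (‖x‖ / ‖T x‖) • T x with hy
  have hyn : ‖y‖ = ‖x‖ := by
    rw [hy, norm_smul, Real.norm_eq_abs, abs_of_nonneg (by positivity), div_mul_cancel₀ _ hTx]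
  have h1 : ⟪T x, y⟫ = ‖x‖ * ‖T x‖ := by
    rw [hy, inner_smul_right, real_inner_self_eq_norm_sq]
    field_simp
  have h2 : 4 * ⟪T x, y⟫ = ⟪T (x + y), x + y⟫ - ⟪T (x - y), x - y⟫ := by
    have h3 : ⟪T y, x⟫ = ⟪T x, y⟫ := by rw [hT, real_inner_comm]
    simp only [map_add, map_sub, inner_add_left, inner_add_right, inner_sub_left, inner_sub_right,
      h3]
    ring
  have h4 := (abs_le.1 (h (x + y))).2
  have h5 := (abs_le.1 (h (x - y))).1
  have h6 := parallelogram_law_with_norm ℝ x y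
  rw [hyn] at h6
  have h7 : ‖x‖ * ‖T x‖ ≤ ‖x‖ * (c * ‖x‖) := by nlinarith
  exact le_of_mul_le_mul_left h7 hx

/-- A symmetric operator is controlled by its quadratic form on a `1/2`-net of the sphere. -/
theorem norm_le_of_abs_inner_self_le_on_net (hT : ∀ x y, ⟪T x, y⟫ = ⟪x, T y⟫) {s : Set E}
    (hs : ∀ y ∈ s, ‖y‖ = 1) (hnet : ∀ x : E, ‖x‖ = 1 → ∃ y ∈ s, ‖x - y‖ ≤ 1 / 2) {c : ℝ}
    (hc : 0 ≤ c) (h : ∀ y ∈ s, |⟪T y, y⟫| ≤ c) : ‖T‖ ≤ 32 * c := by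
  suffices h1 : ‖T‖ ≤ c + 31 / 32 * ‖T‖ by linarith
  have hunit : ∀ x, ‖x‖ = 1 → |⟪T x, x⟫| ≤ c + 31 / 32 * ‖T‖ := by
    intro x hx
    obtain ⟨y, hy, hxy⟩ := hnet x hx
    have h1 : ⟪T x, x⟫ = ⟪T y, y⟫ + ⟪T (x - y), x + y⟫ := by
      have h2 : ⟪T y, x⟫ = ⟪T x, y⟫ := by rw [hT, real_inner_comm]
      simp only [map_sub, inner_sub_left, inner_add_right, h2]
      ring
    -- Bounding `‖x + y‖` by 2 would give only 1 and no contraction. The parallelogram law gives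
    -- `√15 / 4 < 31 / 32`, whence the factor 32.
    have h3 : ‖x - y‖ * ‖x + y‖ ≤ 31 / 32 := by
      have h4 := parallelogram_law_with_norm ℝ x y
      rw [hx, hs y hy] at h4
      have h5 : (‖x - y‖ * ‖x + y‖) ^ 2 ≤ (31 / 32) ^ 2 := by
        have h6 : ‖x + y‖ ^ 2 = 4 - ‖x - y‖ ^ 2 := by linarith
        have h7 : ‖x - y‖ ^ 2 ≤ 1 / 4 := by nlinarith [norm_nonneg (x - y)]
        rw [mul_pow, h6]
        nlinarith [sq_nonneg ‖x - y‖]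
      exact le_of_sq_le_sq h5 (by norm_num)
    have h8 : |⟪T (x - y), x + y⟫| ≤ 31 / 32 * ‖T‖ := by
      calc |⟪T (x - y), x + y⟫| ≤ ‖T (x - y)‖ * ‖x + y‖ := abs_real_inner_le_norm _ _
        _ ≤ (‖T‖ * ‖x - y‖) * ‖x + y‖ :=
            mul_le_mul_of_nonneg_right (T.le_opNorm _) (norm_nonneg _)
        _ = ‖T‖ * (‖x - y‖ * ‖x + y‖) := mul_assoc _ _ _
        _ ≤ ‖T‖ * (31 / 32) := mul_le_mul_of_nonneg_left h3 (norm_nonneg _)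
        _ = _ := mul_comm _ _
    rw [h1]
    exact (abs_add_le _ _).trans (add_le_add (h y hy) h8)
  refine norm_le_of_abs_inner_self_le hT (by positivity) fun x => ?_
  by_cases hx : x = 0
  · simp [hx]
  have hxn : ‖x‖ ≠ 0 := norm_ne_zero_iff.2 hx
  have h1 := hunit (‖x‖⁻¹ • x) (by rw [norm_smul, norm_inv, norm_norm, inv_mul_cancel₀ hxn])
  rw [map_smul, real_inner_smul_left, real_inner_smul_right, ← mul_assoc, abs_mul, abs_mul_self]
    at h1
  have h2 : |⟪T x, x⟫| = ‖x‖⁻¹ * ‖x‖⁻¹ * |⟪T x, x⟫| * ‖x‖ ^ 2 := by field_simp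
  rw [h2]
  exact mul_le_mul_of_nonneg_right h1 (sq_nonneg _)

end Quadratic

/-! ### Concentration of one quadratic form -/

theorem exp_le_one_add_add_sq_mul_exp_abs (y : ℝ) :
    Real.exp y ≤ 1 + y + y ^ 2 * Real.exp |y| := by
  have h1 : 1 ≤ Real.exp |y| := Real.one_le_exp (abs_nonneg y)
  rcases le_or_gt |y| 1 with h | h
  · have := (abs_le.1 (Real.abs_exp_sub_one_sub_id_le h)).2
    nlinarith [sq_nonneg y]
  · rcases lt_abs.1 h with h | h
    · rw [abs_of_pos (by linarith)]
      nlinarith [Real.exp_pos y, mul_pos (Real.exp_pos y) (show 0 < y ^ 2 - 1 by nlinarith)]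
    · have h2 : Real.exp y ≤ 1 := Real.exp_le_one_iff.2 (by linarith)
      nlinarith [sq_nonneg y]

/-- The linear term integrates to zero under isotropy. In the remainder, `(t² - 1)²` and the
exponential each cost a factor `exp (a |t² - 1|)`; for `2a = 1 / K²` their product is integrable by
the sub-Gaussian hypothesis. -/
theorem exp_mul_sq_sub_one_le {a s t : ℝ} (ha : 0 < a) (hs : |s| ≤ a) :
    Real.exp (s * (t ^ 2 - 1)) ≤ 1 + s * (t ^ 2 - 1)
      + s ^ 2 * (2 / a ^ 2 * Real.exp (2 * a)) * Real.exp (2 * a * t ^ 2) := by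
  set z := t ^ 2 - 1 with hz
  have h1 := exp_le_one_add_add_sq_mul_exp_abs (s * z)
  have hza : |z| ≤ t ^ 2 + 1 := by
    rw [abs_le]; constructor <;> nlinarith [sq_nonneg t]
  have h2 : Real.exp |s * z| ≤ Real.exp (a * |z|) := by
    rw [abs_mul]
    exact Real.exp_le_exp.2 (mul_le_mul_of_nonneg_right hs (abs_nonneg z))
  have h3 : z ^ 2 ≤ 2 / a ^ 2 * Real.exp (a * |z|) := by
    have h4 := Real.pow_div_factorial_le_exp (x := a * |z|) (by positivity) 2
    rw [mul_pow, sq_abs] at h4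
    norm_num at h4
    rw [div_mul_eq_mul_div, le_div_iff₀ (by positivity)]
    linarith
  have h5 : Real.exp (a * |z|) * Real.exp (a * |z|) ≤
      Real.exp (2 * a) * Real.exp (2 * a * t ^ 2) := by
    rw [← Real.exp_add, ← Real.exp_add]
    exact Real.exp_le_exp.2 (by nlinarith)
  have h6 : (s * z) ^ 2 * Real.exp |s * z|
      ≤ s ^ 2 * (2 / a ^ 2 * Real.exp (2 * a)) * Real.exp (2 * a * t ^ 2) := by
    calc (s * z) ^ 2 * Real.exp |s * z|
        ≤ (s ^ 2 * (2 / a ^ 2 * Real.exp (a * |z|))) * Real.exp (a * |z|) := by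
          rw [mul_pow]
          gcongr
      _ = s ^ 2 * (2 / a ^ 2) * (Real.exp (a * |z|) * Real.exp (a * |z|)) := by ring
      _ ≤ s ^ 2 * (2 / a ^ 2) * (Real.exp (2 * a) * Real.exp (2 * a * t ^ 2)) :=
          mul_le_mul_of_nonneg_left h5 (by positivity)
      _ = _ := by ring
  linarith

namespace IsIsotropicSubGaussian

variable {d : ℕ} {μ : Measure (EuclideanSpace ℝ (Fin d))} {K : ℝ}

theorem integrable_mul (h : IsIsotropicSubGaussian μ K) (i j : Fin d) :
    Integrable (fun x => x i * x j) μ := by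
  have hsq : ∀ i, Integrable (fun x : EuclideanSpace ℝ (Fin d) => x i * x i) μ := fun i => by
    -- Isotropy encodes integrability: a non-integrable square would have integral 0 by convention,
    -- not 1.
    by_contra hn
    have := h.isotropic i i
    rw [integral_undef hn] at this
    simp at this
  refine ((hsq i).add (hsq j)).mono' (by fun_prop) (ae_of_all _ fun x => ?_)
  rw [Real.norm_eq_abs, Pi.add_apply, abs_le]
  constructor <;> nlinarith [sq_nonneg (x i + x j), sq_nonneg (x i - x j)]

theorem inner_sq_eq (u x : EuclideanSpace ℝ (Fin d)) :
    ⟪u, x⟫ ^ 2 = ∑ i, ∑ j, u i * u j * (x i * x j) := by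
  rw [sq, PiLp.inner_apply, Finset.sum_mul_sum]
  refine Finset.sum_congr rfl fun i _ => Finset.sum_congr rfl fun j _ => ?_
  simp
  ring

theorem integrable_inner_sq (h : IsIsotropicSubGaussian μ K) (u : EuclideanSpace ℝ (Fin d)) :
    Integrable (fun x => ⟪u, x⟫ ^ 2) μ := by
  simp only [inner_sq_eq]
  exact integrable_finsetSum _ fun i _ => integrable_finsetSum _ fun j _ =>
    (h.integrable_mul i j).const_mul _

theorem integral_inner_sq (h : IsIsotropicSubGaussian μ K) {u : EuclideanSpace ℝ (Fin d)}
    (hu : ‖u‖ = 1) : ∫ x, ⟪u, x⟫ ^ 2 ∂μ = 1 := by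
  simp only [inner_sq_eq]
  rw [integral_finsetSum _ fun i _ => integrable_finsetSum _ fun j _ =>
    (h.integrable_mul i j).const_mul _]
  have h1 : ∀ i, ∫ x : EuclideanSpace ℝ (Fin d), ∑ j, u i * u j * (x i * x j) ∂μ = u i ^ 2 := by
    intro i
    rw [integral_finsetSum _ fun j _ => (h.integrable_mul i j).const_mul _]
    simp [integral_const_mul, h.isotropic, sq]
  simp only [h1]
  rw [← EuclideanSpace.real_norm_sq_eq, hu, one_pow]

theorem integrable_exp_and_integral_le (h : IsIsotropicSubGaussian μ K)
    {u : EuclideanSpace ℝ (Fin d)} (hu : ‖u‖ = 1) :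
    Integrable (fun x => Real.exp (⟪u, x⟫ ^ 2 / K ^ 2)) μ ∧
      ∫ x, Real.exp (⟪u, x⟫ ^ 2 / K ^ 2) ∂μ ≤ 2 := by
  have hm : AEStronglyMeasurable (fun x => Real.exp (⟪u, x⟫ ^ 2 / K ^ 2)) μ := by fun_prop
  have h2 := h.subGaussian u hu
  refine ⟨⟨hm, ?_⟩, ?_⟩
  · rw [hasFiniteIntegral_iff_ofReal (ae_of_all _ fun x => (Real.exp_pos _).le)]
    exact h2.trans_lt (by norm_num)
  · rw [integral_eq_lintegral_of_nonneg_ae (ae_of_all _ fun x => (Real.exp_pos _).le) hm]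
    exact ENNReal.toReal_le_of_le_ofReal (by norm_num) (by simpa using h2)

/-- The Bernstein moment condition for `⟨u, x⟩² - 1`. -/
theorem integrable_exp_mul_and_integral_le (h : IsIsotropicSubGaussian μ K) (hK : 0 < K)
    {u : EuclideanSpace ℝ (Fin d)} (hu : ‖u‖ = 1) {a s : ℝ} (ha : a = 1 / (2 * K ^ 2))
    (hs : |s| ≤ a) :
    Integrable (fun x => Real.exp (s * (⟪u, x⟫ ^ 2 - 1))) μ ∧
      ∫ x, Real.exp (s * (⟪u, x⟫ ^ 2 - 1)) ∂μ
        ≤ Real.exp (4 / a ^ 2 * Real.exp (2 * a) * s ^ 2) := by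
  have := h.isProbabilityMeasure
  have hapos : 0 < a := by rw [ha]; positivity
  have hle : ∀ x : EuclideanSpace ℝ (Fin d), Real.exp (s * (⟪u, x⟫ ^ 2 - 1)) ≤
      1 + s * (⟪u, x⟫ ^ 2 - 1)
        + s ^ 2 * (2 / a ^ 2 * Real.exp (2 * a)) * Real.exp (⟪u, x⟫ ^ 2 / K ^ 2) := by
    intro x
    have h1 := exp_mul_sq_sub_one_le (t := ⟪u, x⟫) hapos hs
    have h2 : 2 * a * ⟪u, x⟫ ^ 2 = ⟪u, x⟫ ^ 2 / K ^ 2 := by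
      rw [ha]; field_simp
    rwa [h2] at h1
  obtain ⟨he, he2⟩ := h.integrable_exp_and_integral_le hu
  have hq := h.integrable_inner_sq u
  have i1 : Integrable (fun x => s * (⟪u, x⟫ ^ 2 - 1)) μ :=
    (hq.sub (integrable_const 1)).const_mul s
  have i2 : Integrable (fun x => 1 + s * (⟪u, x⟫ ^ 2 - 1)) μ := (integrable_const 1).add i1
  have i3 := he.const_mul (s ^ 2 * (2 / a ^ 2 * Real.exp (2 * a)))
  have hint : Integrable (fun x => Real.exp (s * (⟪u, x⟫ ^ 2 - 1))) μ := by
    refine (i2.add i3).mono' (by fun_prop) (ae_of_all _ fun x => ?_)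
    rw [Real.norm_eq_abs, Real.abs_exp]
    exact hle x
  refine ⟨hint, ?_⟩
  have hz : ∫ x, s * (⟪u, x⟫ ^ 2 - 1) ∂μ = 0 := by
    rw [integral_const_mul, integral_sub hq (integrable_const 1), h.integral_inner_sq hu]
    simp
  calc ∫ x, Real.exp (s * (⟪u, x⟫ ^ 2 - 1)) ∂μ
      ≤ ∫ x, (1 + s * (⟪u, x⟫ ^ 2 - 1)
        + s ^ 2 * (2 / a ^ 2 * Real.exp (2 * a)) * Real.exp (⟪u, x⟫ ^ 2 / K ^ 2)) ∂μ :=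
        integral_mono hint (i2.add i3) hle
    _ = 1 + s ^ 2 * (2 / a ^ 2 * Real.exp (2 * a))
          * ∫ x, Real.exp (⟪u, x⟫ ^ 2 / K ^ 2) ∂μ := by
        rw [integral_add i2 i3, integral_add (integrable_const 1) i1, hz, integral_const_mul]
        simp
    _ ≤ 1 + s ^ 2 * (2 / a ^ 2 * Real.exp (2 * a)) * 2 := by gcongr
    _ = 4 / a ^ 2 * Real.exp (2 * a) * s ^ 2 + 1 := by ring
    _ ≤ _ := Real.add_one_le_exp _

end IsIsotropicSubGaussian

section Chernoff

variable {Ω : Type*} [MeasurableSpace Ω] {P : Measure Ω} [IsProbabilityMeasure P] {N : ℕ}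

/-- Bernstein's inequality for small deviations, from a bound on moment generating functions. -/
theorem measureReal_abs_sum_ge_le {Y : Fin N → Ω → ℝ} (hY : iIndepFun Y P)
    (hm : ∀ i, AEMeasurable (Y i) P) {b M : ℝ} (hb : 0 < b) (hbM : M * b ≤ 1 / 2)
    (hmgf : ∀ s, |s| ≤ b → ∀ i, Integrable (fun ω => Real.exp (s * Y i ω)) P ∧
      mgf (Y i) P s ≤ Real.exp (M * s ^ 2)) {τ : ℝ} (hτ0 : 0 ≤ τ) (hτ1 : τ ≤ 1) :
    P.real {ω | N * τ ≤ |∑ i, Y i ω|} ≤ 2 * Real.exp (-(b / 2 * τ ^ 2 * N)) := by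
  have hsum : ∀ s, |s| ≤ b → Integrable (fun ω => Real.exp (s * (∑ i, Y i) ω)) P ∧
      mgf (∑ i, Y i) P s ≤ Real.exp (N * (M * s ^ 2)) := by
    intro s hs
    refine ⟨?_, ?_⟩
    -- Otherwise the moment generating function would be 0 by convention, whereas independence makes
    -- it a product of positive numbers.
    · by_contra hn
      have h0 : mgf (∑ i, Y i) P s = 0 := integral_undef hn
      rw [hY.mgf_sum₀ hm] at h0
      exact (Finset.prod_pos fun i _ => mgf_pos (hmgf s hs i).1).ne' h0
    rw [hY.mgf_sum₀ hm, Real.exp_nat_mul]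
    calc ∏ i, mgf (Y i) P s ≤ ∏ _i : Fin N, Real.exp (M * s ^ 2) :=
          Finset.prod_le_prod (fun i _ => mgf_nonneg) fun i _ => (hmgf s hs i).2
      _ = _ := by simp
  have hN : (0 : ℝ) ≤ N := Nat.cast_nonneg N
  -- The Chernoff parameter is `b τ`, admissible since `τ ≤ 1`; `M b ≤ 1/2` lets the quadratic term
  -- absorb at most half of the linear gain.
  have hexp : -(b * τ) * (N * τ) + N * (M * (b * τ) ^ 2) ≤ -(b / 2 * τ ^ 2 * N) := by
    have : 0 ≤ N * τ ^ 2 * b := by positivity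
    nlinarith
  have hsτ : |b * τ| ≤ b := by
    rw [abs_of_nonneg (by positivity)]
    exact mul_le_of_le_one_right hb.le hτ1
  have h1 : P.real {ω | N * τ ≤ (∑ i, Y i) ω} ≤ Real.exp (-(b / 2 * τ ^ 2 * N)) := by
    obtain ⟨hi, hg⟩ := hsum (b * τ) hsτ
    refine (measure_ge_le_exp_mul_mgf _ (by positivity) hi).trans ?_
    refine (mul_le_mul_of_nonneg_left hg (Real.exp_pos _).le).trans ?_
    rw [← Real.exp_add]
    exact Real.exp_le_exp.2 hexp
  have h2 : P.real {ω | (∑ i, Y i) ω ≤ -(N * τ)} ≤ Real.exp (-(b / 2 * τ ^ 2 * N)) := by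
    obtain ⟨hi, hg⟩ := hsum (-(b * τ)) (by rwa [abs_neg])
    refine (measure_le_le_exp_mul_mgf _ (by nlinarith [mul_nonneg hb.le hτ0]) hi).trans ?_
    refine (mul_le_mul_of_nonneg_left hg (Real.exp_pos _).le).trans ?_
    rw [← Real.exp_add]
    exact Real.exp_le_exp.2 (by rw [neg_sq]; linarith)
  have h3 : {ω | N * τ ≤ |∑ i, Y i ω|} ⊆
      {ω | N * τ ≤ (∑ i, Y i) ω} ∪ {ω | (∑ i, Y i) ω ≤ -(N * τ)} := by
    intro ω hω
    simp only [Set.mem_union, Set.mem_ofPred_eq, Finset.sum_apply] at hω ⊢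
    rcases le_abs.1 hω with h | h
    · exact Or.inl h
    · exact Or.inr (by linarith)
  refine (measureReal_mono h3).trans ((measureReal_union_le _ _).trans ?_)
  linarith

end Chernoff

/-! ### Concentration of the sample covariance -/

theorem inner_empiricalCovariance_sub_one {N d : ℕ} (hN : 0 < N)
    (x : Fin N → EuclideanSpace ℝ (Fin d)) {u : EuclideanSpace ℝ (Fin d)} (hu : ‖u‖ = 1) :
    ⟪Matrix.toEuclideanCLM (n := Fin d) (𝕜 := ℝ)
      (empiricalCovariance (dataMatrix x) - 1) u, u⟫ =
      (1 / (N : ℝ)) * ∑ i, (⟪u, x i⟫ ^ 2 - 1) := by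
  have h1 : ∀ i, (dataMatrix x *ᵥ u.ofLp) i = ⟪u, x i⟫ := fun i => by
    rw [PiLp.inner_apply]
    simp [dataMatrix, Matrix.mulVec, dotProduct]
  have h2 : u.ofLp ⬝ᵥ u.ofLp = 1 := by
    rw [← vecNorm_sq, vecNorm]
    simp [hu]
  rw [EuclideanSpace.inner_eq_star_dotProduct, Matrix.ofLp_toEuclideanCLM, star_trivial,
    Matrix.sub_mulVec, dotProduct_sub, Matrix.one_mulVec, h2, empiricalCovariance,
    Matrix.smul_mulVec, dotProduct_smul, ← Matrix.mulVec_mulVec,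
    Matrix.dotProduct_transpose_mulVec, Finset.sum_sub_distrib]
  simp only [dotProduct, h1, smul_eq_mul, ← sq]
  have : (N : ℝ) ≠ 0 := by positivity
  simp
  field_simp

theorem isSymmetric_toEuclideanCLM {d : ℕ} {M : Matrix (Fin d) (Fin d) ℝ} (hM : Mᵀ = M)
    (x y : EuclideanSpace ℝ (Fin d)) :
    ⟪Matrix.toEuclideanCLM (n := Fin d) (𝕜 := ℝ) M x, y⟫ =
      ⟪x, Matrix.toEuclideanCLM (n := Fin d) (𝕜 := ℝ) M y⟫ := by
  rw [EuclideanSpace.inner_eq_star_dotProduct, EuclideanSpace.inner_eq_star_dotProduct,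
    Matrix.ofLp_toEuclideanCLM, Matrix.ofLp_toEuclideanCLM, star_trivial, star_trivial,
    Matrix.dotProduct_mulVec, ← Matrix.mulVec_transpose, hM]

/-- The sample covariance of isotropic sub-Gaussian data concentrates around the identity. -/
theorem exists_opNorm_empiricalCovariance_sub_one_le {K : ℝ} (hK : 0 < K) :
    ∃ c : ℝ, 0 < c ∧ ∀ {d N : ℕ} (_ : 0 < N) {μ : Measure (EuclideanSpace ℝ (Fin d))}
      (_ : IsIsotropicSubGaussian μ K) {Ω : Type*} [MeasurableSpace Ω] (P : Measure Ω)
      [IsProbabilityMeasure P] {x : Fin N → Ω → EuclideanSpace ℝ (Fin d)}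
      (_ : ∀ i, HasLaw (x i) μ P) (_ : iIndepFun x P) {ε : ℝ} (_ : 0 ≤ ε) (_ : ε ≤ 1),
      P.real {ω | ε < opNorm (empiricalCovariance (dataMatrix fun i => x i ω) - 1)} ≤
        2 * 5 ^ d * Real.exp (-(c * ε ^ 2 * N)) := by
  set a := 1 / (2 * K ^ 2) with ha
  set M := 4 / a ^ 2 * Real.exp (2 * a) with hM
  have hapos : 0 < a := by positivity
  have hMpos : 0 < M := by positivity
  set b := min a (1 / (2 * M)) with hb
  have hbpos : 0 < b := lt_min hapos (by positivity)
  have hbM : M * b ≤ 1 / 2 := by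
    calc M * b ≤ M * (1 / (2 * M)) := mul_le_mul_of_nonneg_left (min_le_right _ _) hMpos.le
      _ = 1 / 2 := by field_simp
  -- `b / 2048 = (b / 2) / 32²`, since each net point is tested at deviation `ε / 32`. As `a`, `M`
  -- and `b` are built from `K` alone, so is this constant.
  refine ⟨b / 2048, by positivity, fun {d N} hN {μ} hμ {Ω} _ P _ {x} hx hind {ε} hε0 hε1 => ?_⟩
  obtain ⟨s, hcard, hs, hnet⟩ := exists_sphere_net d
  have hNpos : (0 : ℝ) < N := Nat.cast_pos.2 hN
  have hone : ∀ u ∈ s, P.real {ω | N * (ε / 32) ≤ |∑ i, (⟪u, x i ω⟫ ^ 2 - 1)|} ≤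
      2 * Real.exp (-(b / 2048 * ε ^ 2 * N)) := by
    intro u hu
    have hg : Measurable fun y : EuclideanSpace ℝ (Fin d) => ⟪u, y⟫ ^ 2 - 1 := by fun_prop
    have h1 := measureReal_abs_sum_ge_le (P := P) (Y := fun i ω => ⟪u, x i ω⟫ ^ 2 - 1)
      (hind.comp (fun _ y => ⟪u, y⟫ ^ 2 - 1) fun _ => hg)
      (fun i => hg.comp_aemeasurable (hx i).aemeasurable) hbpos hbM
      (fun t ht i => by
        obtain ⟨h2, h3⟩ := hμ.integrable_exp_mul_and_integral_le hK (hs u hu) ha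
          (ht.trans (min_le_left _ _))
        refine ⟨?_, ?_⟩
        · rw [← (hx i).map_eq] at h2
          exact h2.comp_aemeasurable (hx i).aemeasurable
        · rw [mgf]
          refine le_of_eq_of_le ?_ h3
          exact (hx i).integral_comp h2.aestronglyMeasurable)
      (τ := ε / 32) (by positivity) (by linarith)
    refine h1.trans_eq ?_
    congr 3
    ring
  have hsub : {ω | ε < opNorm (empiricalCovariance (dataMatrix fun i => x i ω) - 1)} ⊆
      ⋃ u ∈ s, {ω | N * (ε / 32) ≤ |∑ i, (⟪u, x i ω⟫ ^ 2 - 1)|} := by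
    intro ω hω
    by_contra hn
    simp only [Set.mem_iUnion, Set.mem_ofPred_eq, not_exists, not_le] at hn
    refine absurd (Set.mem_ofPred_eq.mp hω) (not_lt.2 ?_)
    have hsymm : (empiricalCovariance (dataMatrix fun i => x i ω) - 1)ᵀ =
        empiricalCovariance (dataMatrix fun i => x i ω) - 1 := by
      simp [empiricalCovariance, Matrix.transpose_mul]
    have h1 := norm_le_of_abs_inner_self_le_on_net (isSymmetric_toEuclideanCLM hsymm)
      (s := (s : Set (EuclideanSpace ℝ (Fin d)))) hs hnet (c := ε / 32) (by positivity)
      (fun u hu => by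
        rw [inner_empiricalCovariance_sub_one hN _ (hs u hu), abs_mul,
          abs_of_pos (by positivity), one_div_mul_eq_div, div_le_iff₀ hNpos, mul_comm]
        exact (hn u hu).le)
    rw [opNorm]
    linarith
  calc _ ≤ P.real (⋃ u ∈ s, {ω | N * (ε / 32) ≤ |∑ i, (⟪u, x i ω⟫ ^ 2 - 1)|}) :=
        measureReal_mono hsub (measure_ne_top _ _)
    _ ≤ ∑ u ∈ s, P.real {ω | N * (ε / 32) ≤ |∑ i, (⟪u, x i ω⟫ ^ 2 - 1)|} :=
        measureReal_biUnion_finset_le _ _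
    _ ≤ s.card • (2 * Real.exp (-(b / 2048 * ε ^ 2 * N))) := Finset.sum_le_card_nsmul _ _ _ hone
    _ ≤ 5 ^ d * (2 * Real.exp (-(b / 2048 * ε ^ 2 * N))) := by
        rw [nsmul_eq_mul]
        gcongr
        exact_mod_cast hcard
    _ = _ := by ring

end LoRA

theorem mainTheorem2 :
    ∃ C : ℝ, 0 < C ∧ ∀ K : ℝ, 0 < K → ∃ c : ℝ, 0 < c ∧
      ∀ (d k r N : ℕ) (hrd : r ≤ d) (hrk : r ≤ k) (_ : d < N)
        (W Δ : Matrix (Fin d) (Fin k) ℝ)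
        (_ : 1 ≤ Δ.rank) (_ : Δ.rank < min d k) (_ : Δ.rank ≤ r)
        (μ : Measure (EuclideanSpace ℝ (Fin d))) (_ : LoRA.IsIsotropicSubGaussian μ K)
        (Ω : Type*) [MeasurableSpace Ω] (P : Measure Ω) [IsProbabilityMeasure P]
        (x : Fin N → Ω → EuclideanSpace ℝ (Fin d))
        (_ : ∀ i, HasLaw (x i) μ P) (_ : iIndepFun x P)
        (ε η : ℝ) (_ : 0 < ε)
        (_ : ε ≤ min (1 / (2 * √(Δ.rank : ℝ) * LoRA.conditionNumber Δ)) (1 / 4))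
        (_ : η ∈ Set.Ioo 0 ((1 / 2 - 2 * ε) / (1 + ε) ^ 2)),
        ∃ E : Set Ω, MeasurableSet E ∧
          1 - 2 * C ^ d * Real.exp (-(c * ε ^ 2 * (N : ℝ))) ≤ P.real E ∧
          ∀ ω ∈ E,
            let X := LoRA.dataMatrix fun i => x i ω
            let Y := LoRA.labelMatrix X W Δ
            LoRA.opNorm (LoRA.empiricalCovariance X - 1) ≤ ε ∧
            ∀ (U : Matrix (Fin d) (Fin d) ℝ) (σ : Fin (min d k) → ℝ)
              (V : Matrix (Fin k) (Fin k) ℝ),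
              LoRA.IsSVD (-LoRA.fullGradient X Y W) U σ V →
              ∀ t : ℕ,
                LoRA.frobeniusNorm
                    ((LoRA.precGD X Y W η (LoRA.spectralInitA hrd hrk U σ)
                        (LoRA.spectralInitB hrd hrk σ V) t).1 *
                      (LoRA.precGD X Y W η (LoRA.spectralInitA hrd hrk U σ)
                        (LoRA.spectralInitB hrd hrk σ V) t).2 - Δ)
                  ≤ 1 / 2 * (1 - η / 2) ^ t * LoRA.singularValue Δ Δ.rank := by
  refine ⟨5, by norm_num, fun K hK => ?_⟩
  obtain ⟨c, hc, hconc⟩ := LoRA.exists_opNorm_empiricalCovariance_sub_one_le hK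
  refine ⟨c, hc, ?_⟩
  intro d k r N hrd hrk hdN W Δ hrank _ hr μ hμ Ω _ P _ x hx hind ε η hε hεle hη
  set bad := {ω | ε < LoRA.opNorm (LoRA.empiricalCovariance
    (LoRA.dataMatrix fun i => x i ω) - 1)} with hbad
  -- The samples are only almost everywhere measurable, so `bad` need not be a measurable set; its
  -- measurable hull has the same measure.
  refine ⟨(toMeasurable P bad)ᶜ, (measurableSet_toMeasurable P bad).compl, ?_, fun ω hω => ?_⟩
  · have h1 := hconc (by omega : 0 < N) hμ P hx hind hε.le
      ((hεle.trans (min_le_right _ _)).trans (by norm_num))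
    rw [probReal_compl_eq_one_sub (measurableSet_toMeasurable P bad), measureReal_def,
      measure_toMeasurable, ← measureReal_def]
    linarith
  · have hH : LoRA.opNorm (LoRA.empiricalCovariance (LoRA.dataMatrix fun i => x i ω) - 1) ≤ ε :=
      not_lt.1 fun h => hω (subset_toMeasurable P bad h)
    exact ⟨hH, fun U σ V h t => LoRA.precGD_spectralInit_converges hrd hrk hrank hr
      (hεle.trans (min_le_left _ _)) hη hH h t⟩
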